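/- Let $E_n$ be the edge set of the complete graph $K_n$ on $n$ vertices. For a mapping $f:E_n\to E_n$, a subgraph $S$ of $K_n$ is called $f$-fixed if $f(e)=e$ for all $e\in E(S)$, and $f$-free if $f(e)\notin E(S)$ for all $e\in E(S)$. For finite graphs $G,H$ let $m(G,H)$ be the smallest integer $n$ such that for every mapping $f:E_n\to E_n$ there is an $f$-fixed copy of $G$ or an $f$-free copy of $H$ in $K_n$ (a copy being a, not necessarily induced, subgraph isomorphic to the given graph). Let $K_k^{-t}$ be the graph obtained from $K_k$ by removing the edges of a $t$-clique, that is, all edges between some fixed $t$ vertices; let $K_{1,r}$ be the star with $r$ edges, $C_\ell$ the cycle on $\ell$ vertices, and $G+H$ the join of $G$ and $H$ (their vertex-disjoint union together with all edges between them; $K_0$ is the empty graph). Let $k,t,r$ be integers. 1. If $t\ge 1$, $k\ge t+2$ and $r\ge \frac{3t}{2}-1$, then $m(K_k^{-t},K_{1,r})=(k-t)(2r-1)+1$. 2. If $k\ge 3$, $r\ge k-1$ and $t\ge 0$, then $m(C_{2k-1}+K_t,K_{1,r})=(t+2)(2r-1)+1$. -/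

import Mathlib

/-- `E_n`, the set of edges of the complete graph on `n` vertices. -/
abbrev CompleteEdges (n : ℕ) : Type := (⊤ : SimpleGraph (Fin n)).edgeSet

/-- A subgraph `S` of `K_n` is `f`-fixed if `f e = e` for every edge `e` of `S`. -/
def IsFixedBy {n : ℕ} (f : CompleteEdges n → CompleteEdges n)
    (S : (⊤ : SimpleGraph (Fin n)).Subgraph) : Prop :=
  ∀ e : CompleteEdges n, (e : Sym2 (Fin n)) ∈ S.edgeSet → f e = e

/-- A subgraph `S` of `K_n` is `f`-free if `f e` is not an edge of `S`
for every edge `e` of `S`. -/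
def IsFreeFor {n : ℕ} (f : CompleteEdges n → CompleteEdges n)
    (S : (⊤ : SimpleGraph (Fin n)).Subgraph) : Prop :=
  ∀ e : CompleteEdges n, (e : Sym2 (Fin n)) ∈ S.edgeSet →
    (f e : Sym2 (Fin n)) ∉ S.edgeSet

/-- The set of all `n` such that every `f : E_n → E_n` admits an `f`-fixed copy of `G` or an
`f`-free copy of `H`. A copy is a (not necessarily induced) subgraph of `K_n` isomorphic to
the given graph. -/
def mixedRamseySet {V W : Type*} (G : SimpleGraph V) (H : SimpleGraph W) : Set ℕ :=
  {n | ∀ f : CompleteEdges n → CompleteEdges n,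
    (∃ S : (⊤ : SimpleGraph (Fin n)).Subgraph, Nonempty (G ≃g S.coe) ∧ IsFixedBy f S) ∨
    (∃ S : (⊤ : SimpleGraph (Fin n)).Subgraph, Nonempty (H ≃g S.coe) ∧ IsFreeFor f S)}

/-- `m(G, H) = v`: the minimum of `mixedRamseySet G H` exists and equals `v`. -/
def MixedRamseyEq {V W : Type*} (G : SimpleGraph V) (H : SimpleGraph W) (v : ℕ) : Prop :=
  IsLeast (mixedRamseySet G H) v

/-- The star `K_{1,r}`. -/
abbrev starK (r : ℕ) : SimpleGraph (Fin 1 ⊕ Fin r) :=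
  completeBipartiteGraph (Fin 1) (Fin r)

/-- `K_k^{-t}`: the complete graph on `k` vertices with all the edges between
`t` of its vertices (the first `t`) removed. -/
def completeMinusClique (k t : ℕ) : SimpleGraph (Fin k) where
  Adj i j := i ≠ j ∧ ¬(i.val < t ∧ j.val < t)
  symm := ⟨fun _ _ h => ⟨h.1.symm, fun h' => h.2 h'.symm⟩⟩
  loopless := ⟨fun _ h => h.1 rfl⟩

/-- The join `G + H`: the disjoint union of `G` and `H` with all edges between the two parts
added. -/
def graphJoin {V W : Type*} (G : SimpleGraph V) (H : SimpleGraph W) : SimpleGraph (V ⊕ W) :=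
  (G ⊕g H) ⊔ completeBipartiteGraph V W

/-! Both equalities follow one pattern: the value is `s * (2 * r - 1) + 1`, where the fixed graph
`G` sought has no proper colouring with `s` colours.

Lower bound (`not_mem_mixedRamseySet`). Cut at most `s * (2 * r - 1)` vertices into `s` blocks of at
most `2r - 1` consecutive ones. Fix every edge between blocks and no edge inside one, so that the
fixed graph is `s`-partite and contains no `G`. Inside a block, positions modulo `2r - 1` orient the
edges, with out-degree at most `r - 1`; an edge from `x` to `x + d` is sent to the edge from `x` to
`x - d`, if that exists. The nonzero residues form only `r - 1` pairs `{d, -d}`, so a star with `r`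
edges in a block contains an opposite pair, one edge of which is mapped to the other.

Upper bound. The image of a non-fixed edge cannot share both of its ends, so the edge can be charged
to an end that misses the image. Edges charged to one vertex form a free star, so without a free
`K_{1,r}` each vertex is charged at most `r - 1` times. Hence in every vertex set the non-fixed
edges have average degree at most `2r - 2` (`degSum_fixedGraph`). Repeatedly passing to the fixed
neighbourhood of a vertex of large degree costs `2r - 1` vertices each time and builds a fixed
clique completely joined to a set of `4r - 1` vertices (`exists_dense_of_no_free_star`). On that set
the fixed graph has average degree at least `2r`, more than half the order.

Two extremal theorems then finish. A graph of order `n` with more than `n ^ 2 / 4` edges has an edge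
in more than `n / 6` triangles (`exists_large_codegree`), giving a book with `t` pages; adding the
clique makes `K_k^{-t}`. The same density yields cycles of all lengths from `3` to `2r + 1`
(`exists_cycle_of_degSum`), from a long Erdős–Gallai cycle in a minimal dense subset, where the
longest cycle is Hamiltonian and Bondy's pancyclicity argument applies. -/

open Classical in
/-- The number of neighbours of `v` in `W`. -/
noncomputable def degIn {V : Type*} (G : SimpleGraph V) (W : Finset V) (v : V) : ℕ :=
  (W.filter (G.Adj v)).card

/-- The sum of the degrees in the subgraph induced by `W`. -/
noncomputable def degSum {V : Type*} (G : SimpleGraph V) (W : Finset V) : ℕ :=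
  ∑ v ∈ W, degIn G W v

/-- `v 0, …, v (p - 1)` is a path inside `W`. -/
structure IsPathSeq {V : Type*} (G : SimpleGraph V) (W : Finset V) (p : ℕ) (v : ℕ → V) :
    Prop where
  inj : ∀ i j, i < p → j < p → v i = v j → i = j
  mem : ∀ i, i < p → v i ∈ W
  adj : ∀ i, i + 1 < p → G.Adj (v i) (v (i + 1))

/-- `v 0, …, v (c - 1)` is a cycle inside `W`. -/
structure IsCycleSeq {V : Type*} (G : SimpleGraph V) (W : Finset V) (c : ℕ) (v : ℕ → V) : Prop
    extends IsPathSeq G W c v where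
  three_le : 3 ≤ c
  close : G.Adj (v (c - 1)) (v 0)

/-! ### Degree sums under deletion of vertices. -/

section Degrees

variable {V : Type*} {G : SimpleGraph V}

open Classical in
theorem degIn_union {A B : Finset V} (h : Disjoint A B) (v : V) :
    degIn G (A ∪ B) v = degIn G A v + degIn G B v := by
  unfold degIn
  rw [Finset.filter_union, Finset.card_union_of_disjoint]
  exact Finset.disjoint_filter_filter h

open Classical in
theorem sum_degIn_comm (A B : Finset V) :
    ∑ v ∈ A, degIn G B v = ∑ v ∈ B, degIn G A v := by
  simp only [degIn, Finset.card_filter]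
  rw [Finset.sum_comm]
  simp only [G.adj_comm]

-- An edge inside `L` contributes 2 through `degIn G W` at its two ends; an edge leaving `L`
-- contributes 1 through each of the two terms at its end in `L`. So the second sum is twice the
-- number of edges destroyed.
open Classical in
theorem degSum_sdiff {W L : Finset V} (h : L ⊆ W) :
    degSum G W = degSum G (W \ L) + ∑ v ∈ L, (degIn G W v + degIn G (W \ L) v) := by
  have e : (W \ L) ∪ L = W := Finset.sdiff_union_of_subset h
  have d : Disjoint (W \ L) L := Finset.sdiff_disjoint
  have key : ∀ v, degIn G W v = degIn G (W \ L) v + degIn G L v := fun v => by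
    rw [← degIn_union d, e]
  have : degSum G W = ∑ v ∈ (W \ L), degIn G W v + ∑ v ∈ L, degIn G W v := by
    rw [← Finset.sum_union d, e]; rfl
  rw [this, Finset.sum_add_distrib]
  have h2 : ∑ v ∈ (W \ L), degIn G W v = degSum G (W \ L) + ∑ v ∈ (W \ L), degIn G L v := by
    simp only [key, Finset.sum_add_distrib]; rfl
  rw [h2, sum_degIn_comm (W \ L) L]
  omega

open Classical in
theorem degIn_erase_self (W : Finset V) (v : V) : degIn G (W.erase v) v = degIn G W v := by
  unfold degIn
  congr 1
  ext u
  simp only [Finset.mem_filter, Finset.mem_erase]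
  constructor
  · rintro ⟨⟨_, h⟩, h'⟩; exact ⟨h, h'⟩
  · rintro ⟨h, h'⟩; exact ⟨⟨h'.ne', h⟩, h'⟩

open Classical in
theorem degSum_erase {W : Finset V} {v : V} (h : v ∈ W) :
    degSum G W = degSum G (W.erase v) + 2 * degIn G W v := by
  rw [degSum_sdiff (Finset.singleton_subset_iff.2 h), Finset.sdiff_singleton_eq_erase]
  simp only [Finset.sum_singleton, degIn_erase_self]
  omega

theorem degIn_le_of_subset {W : Finset V} {v : V} {X : Finset V}
    (h : ∀ u ∈ W, G.Adj v u → u ∈ X) : degIn G W v ≤ X.card := by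
  classical
  unfold degIn
  exact Finset.card_le_card fun u hu => by
    rw [Finset.mem_filter] at hu; exact h u hu.1 hu.2

end Degrees

/-! ### Longest paths, rotations and the Erdős–Gallai bound. -/

section Paths

variable {V : Type*} {G : SimpleGraph V} {W : Finset V}

theorem IsPathSeq.card_le {p : ℕ} {v : ℕ → V} (h : IsPathSeq G W p v) : p ≤ W.card := by
  classical
  have : ((Finset.range p).image v).card = p := by
    rw [Finset.card_image_of_injOn, Finset.card_range]
    intro i hi j hj e
    exact h.inj i j (by simpa using hi) (by simpa using hj) e
  rw [← this]
  refine Finset.card_le_card fun x hx => ?_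
  simp only [Finset.mem_image, Finset.mem_range] at hx
  obtain ⟨i, hi, rfl⟩ := hx
  exact h.mem i hi

theorem IsPathSeq.mono {p : ℕ} {v : ℕ → V} {W' : Finset V} (h : IsPathSeq G W p v)
    (hW : ∀ i, i < p → v i ∈ W') : IsPathSeq G W' p v :=
  ⟨h.inj, hW, h.adj⟩

theorem IsCycleSeq.mono {p : ℕ} {v : ℕ → V} {W' : Finset V} (h : IsCycleSeq G W p v)
    (hW : ∀ i, i < p → v i ∈ W') : IsCycleSeq G W' p v :=
  ⟨h.toIsPathSeq.mono hW, h.three_le, h.close⟩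

theorem IsPathSeq.reverse {p : ℕ} {v : ℕ → V} (h : IsPathSeq G W p v) :
    IsPathSeq G W p (fun i => v (p - 1 - i)) where
  inj i j hi hj e := by
    have := h.inj _ _ (by omega) (by omega) e
    omega
  mem i hi := h.mem _ (by omega)
  adj i hi := by
    have := h.adj (p - 1 - (i + 1)) (by omega)
    rw [show p - 1 - (i + 1) + 1 = p - 1 - i by omega] at this
    exact this.symm

/-- Rotating a path at a neighbour `v i` of its start. -/
theorem IsPathSeq.rotate {p i : ℕ} {v : ℕ → V} (h : IsPathSeq G W p v) (hi : i < p)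
    (ha : G.Adj (v 0) (v i)) :
    IsPathSeq G W p (fun j => v (if j < i then i - 1 - j else j)) where
  inj a b hap hb e := by
    have := h.inj _ _ (by split_ifs <;> omega) (by split_ifs <;> omega) e
    split_ifs at this <;> omega
  mem a hap := h.mem _ (by split_ifs <;> omega)
  adj a hap := by
    rcases lt_trichotomy (a + 1) i with h1 | h1 | h1
    · have := h.adj (i - 1 - (a + 1)) (by omega)
      rw [show i - 1 - (a + 1) + 1 = i - 1 - a by omega] at this
      simp only [h1, if_true, show a < i by omega]
      exact this.symm
    · subst h1
      simpa using ha
    · simpa [show ¬ a < i by omega, show ¬ a + 1 < i by omega] using h.adj a hap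

theorem IsPathSeq.cons {p : ℕ} {v : ℕ → V} (h : IsPathSeq G W p v) {u : V} (hu : u ∈ W)
    (hp : 0 < p) (hn : ∀ i < p, v i ≠ u) (ha : G.Adj u (v 0)) :
    IsPathSeq G W (p + 1) (fun j => if j = 0 then u else v (j - 1)) where
  inj a b hap hb e := by
    by_cases h1 : a = 0 <;> by_cases h2 : b = 0
    · omega
    · simp only [h1, h2, if_true, if_false] at e
      exact absurd e.symm (hn _ (by omega))
    · simp only [h1, h2, if_true, if_false] at e
      exact absurd e (hn _ (by omega))
    · simp only [h1, h2, if_false] at e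
      have := h.inj _ _ (by omega) (by omega) e
      omega
  mem a hap := by
    by_cases h1 : a = 0
    · simpa [h1] using hu
    · simpa [h1] using h.mem _ (by omega)
  adj a hap := by
    by_cases h1 : a = 0
    · simpa [h1] using ha
    · have := h.adj (a - 1) (by omega)
      rw [show a - 1 + 1 = a by omega] at this
      simpa [h1] using this

/-- The initial segment of a path closed by an edge from its start. -/
theorem IsPathSeq.toCycle {p i : ℕ} {v : ℕ → V} (h : IsPathSeq G W p v) (hi : i < p)
    (h2 : 2 ≤ i) (ha : G.Adj (v 0) (v i)) : IsCycleSeq G W (i + 1) v where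
  inj a b hap hb := h.inj a b (by omega) (by omega)
  mem a hap := h.mem a (by omega)
  adj a hap := h.adj a (by omega)
  three_le := by omega
  close := by simpa using ha.symm

/-- A neighbour of the start lying off the path could be prepended to it. -/
theorem IsPathSeq.mem_of_longest {p : ℕ} {v : ℕ → V} (h : IsPathSeq G W p v) (hp : 0 < p)
    (hmax : ∀ q u, IsPathSeq G W q u → q ≤ p) {x : V} (hx : x ∈ W) (ha : G.Adj (v 0) x) :
    ∃ i, 0 < i ∧ i < p ∧ v i = x := by
  by_contra hcon
  have hn : ∀ i < p, v i ≠ x := by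
    intro i hi e
    rcases Nat.eq_zero_or_pos i with h0 | h0
    · subst h0; exact ha.ne e
    · exact hcon ⟨i, h0, hi, e⟩
  have := hmax _ _ (h.cons hx hp hn ha.symm)
  omega

theorem exists_longest_path (hW : W.Nonempty) :
    ∃ p v, 0 < p ∧ IsPathSeq G W p v ∧ ∀ q u, IsPathSeq G W q u → q ≤ p := by
  classical
  obtain ⟨x, hx⟩ := hW
  let P : ℕ → Prop := fun p => ∃ v, IsPathSeq G W p v
  have h1 : P 1 := ⟨fun _ => x, ⟨fun i j hi hj _ => by omega, fun _ _ => hx,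
    fun i hi => by omega⟩⟩
  have hb : ∀ p, P p → p ≤ W.card := fun p ⟨v, hv⟩ => hv.card_le
  have hspec := Nat.findGreatest_spec (P := P) (hb 1 h1) h1
  obtain ⟨v, hv⟩ := hspec
  refine ⟨_, v, ?_, hv, fun q u hu => Nat.le_findGreatest (hb q ⟨u, hu⟩) ⟨u, hu⟩⟩
  have := Nat.le_findGreatest (P := P) (hb 1 h1) h1
  omega

theorem exists_longest_cycle {c₀ : ℕ} {v₀ : ℕ → V} (h : IsCycleSeq G W c₀ v₀) :
    ∃ c v, c₀ ≤ c ∧ IsCycleSeq G W c v ∧ ∀ q u, IsCycleSeq G W q u → q ≤ c := by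
  classical
  let P : ℕ → Prop := fun p => ∃ v, IsCycleSeq G W p v
  have hb : ∀ p, P p → p ≤ W.card := fun p ⟨v, hv⟩ => hv.card_le
  obtain ⟨v, hv⟩ := Nat.findGreatest_spec (P := P) (hb _ ⟨_, h⟩) ⟨_, h⟩
  exact ⟨_, v, Nat.le_findGreatest (hb _ ⟨_, h⟩) ⟨_, h⟩, hv,
    fun q u hu => Nat.le_findGreatest (hb q ⟨u, hu⟩) ⟨u, hu⟩⟩

/-- Among the longest paths there is one whose start has maximum degree. -/
theorem exists_longest_path_max_degree (hW : W.Nonempty) :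
    ∃ p v, 0 < p ∧ IsPathSeq G W p v ∧ (∀ q u, IsPathSeq G W q u → q ≤ p) ∧
      ∀ u, IsPathSeq G W p u → degIn G W (u 0) ≤ degIn G W (v 0) := by
  classical
  obtain ⟨p, v, hp, hv, hmax⟩ := exists_longest_path (G := G) hW
  let P : ℕ → Prop := fun d => ∃ u, IsPathSeq G W p u ∧ degIn G W (u 0) = d
  have hb : ∀ d, P d → d ≤ W.card := by
    rintro d ⟨u, -, rfl⟩
    exact degIn_le_of_subset fun u hu _ => hu
  have h0 : P (degIn G W (v 0)) := ⟨v, hv, rfl⟩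
  obtain ⟨u, hu, hd⟩ := Nat.findGreatest_spec (P := P) (hb _ h0) h0
  refine ⟨p, u, hp, hu, hmax, fun u' hu' => ?_⟩
  rw [hd]
  have h1 : P (degIn G W (u' 0)) := ⟨u', hu', rfl⟩
  exact Nat.le_findGreatest (hb _ h1) h1

/-- Erdős and Gallai: a graph without cycles longer than `k` has degree sum at most
`k (n - 1)`. -/
theorem degSum_le_of_cycles_le {k : ℕ} (hk : 2 ≤ k) (W : Finset V) (hW : W.Nonempty)
    (hc : ∀ c v, IsCycleSeq G W c v → c ≤ k) : degSum G W ≤ k * (W.card - 1) := by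
  classical
  induction W using Finset.strongInduction with
  | H W ih =>
  obtain ⟨p, v, hp, hv, hmax, hdeg⟩ := exists_longest_path_max_degree (G := G) hW
  have hv0 := hv.mem 0 hp
  -- By maximality of the path, `I` indexes all neighbours of its start; closing the path at such an
  -- index gives a cycle, so all indices are below `k`.
  set I := (Finset.range p).filter (fun i => 0 < i ∧ G.Adj (v 0) (v i)) with hI
  have hmemI : ∀ i, i ∈ I ↔ i < p ∧ 0 < i ∧ G.Adj (v 0) (v i) := by
    intro i; simp [hI]
  have hIk : ∀ i ∈ I, i + 1 ≤ k := by
    intro i hi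
    obtain ⟨h1, h2, h3⟩ := (hmemI i).1 hi
    by_cases h4 : 2 ≤ i
    · exact hc _ _ (hv.toCycle h1 h4 h3)
    · omega
  have hcardI : degIn G W (v 0) = I.card := by
    unfold degIn
    have : W.filter (G.Adj (v 0)) = I.image v := by
      ext x
      simp only [Finset.mem_filter, Finset.mem_image, hmemI]
      constructor
      · rintro ⟨hx, ha⟩
        obtain ⟨i, h1, h2, rfl⟩ := hv.mem_of_longest hp hmax hx ha
        exact ⟨i, ⟨h2, h1, ha⟩, rfl⟩
      · rintro ⟨i, ⟨h2, h1, ha⟩, rfl⟩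
        exact ⟨hv.mem _ h2, ha⟩
    rw [this, Finset.card_image_of_injOn]
    intro i hi j hj e
    exact hv.inj i j ((hmemI i).1 hi).1 ((hmemI j).1 hj).1 e
  by_cases hd : I.card = 0
  · by_cases hne : (W.erase (v 0)).Nonempty
    · have h1 := ih _ (Finset.erase_ssubset hv0) hne
        (fun c u hu => hc c u (hu.mono fun i hi => Finset.mem_of_mem_erase (hu.mem i hi)))
      rw [degSum_erase hv0, hcardI, hd]
      rw [Finset.card_erase_of_mem hv0] at h1
      refine le_trans ?_ (Nat.mul_le_mul_left k (Nat.sub_le (W.card - 1) 1))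
      omega
    · rw [Finset.not_nonempty_iff_eq_empty] at hne
      rw [degSum_erase hv0, hcardI, hd, hne]
      simp [degSum]
  -- `L` consists of the starts of all rotations of the path. They are starts of longest paths too,
  -- so their degrees are at most `I.card` by the choice of `v`. Deleting `L` will cost at most `k`
  -- per vertex in the degree sum.
  · set L := I.image (fun i => v (i - 1)) with hL
    have hLW : L ⊆ W := by
      intro x hx
      rw [hL, Finset.mem_image] at hx
      obtain ⟨i, hi, rfl⟩ := hx
      exact hv.mem _ (by have := (hmemI i).1 hi; omega)
    have hLcard : L.card = I.card := by
      rw [hL, Finset.card_image_of_injOn]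
      intro i hi j hj e
      have h1 := (hmemI i).1 hi
      have h2 := (hmemI j).1 hj
      have := hv.inj _ _ (by omega) (by omega) e
      omega
    have hlast : v (p - 1) ∈ W \ L := by
      rw [Finset.mem_sdiff]
      refine ⟨hv.mem _ (by omega), fun hx => ?_⟩
      rw [hL, Finset.mem_image] at hx
      obtain ⟨i, hi, e⟩ := hx
      have h1 := (hmemI i).1 hi
      have := hv.inj _ _ (by omega) (by omega) e
      omega
    -- A rotation at an index below `k` only permutes the first `k` vertices of the path, so
    -- neighbours of vertices of `L` all lie in `X`; at most `k - I.card` of them are outside `L`.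
    set X := (Finset.range (min p k)).image v with hX
    have hXcard : X.card ≤ k := by
      refine Finset.card_image_le.trans ?_
      simp
    have hLX : L ⊆ X := by
      intro x hx
      rw [hL, Finset.mem_image] at hx
      obtain ⟨i, hi, rfl⟩ := hx
      have h1 := (hmemI i).1 hi
      have h2 := hIk i hi
      rw [hX, Finset.mem_image]
      exact ⟨i - 1, by rw [Finset.mem_range]; omega, rfl⟩
    have hbound : ∀ z ∈ L, degIn G W z ≤ I.card ∧ degIn G (W \ L) z ≤ k - I.card := by
      intro z hz
      rw [hL, Finset.mem_image] at hz
      obtain ⟨i, hi, rfl⟩ := hz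
      obtain ⟨h1, h2, h3⟩ := (hmemI i).1 hi
      have h4 := hIk i hi
      have hrot := hv.rotate h1 h3
      have hz0 : v (i - 1) = (fun j => v (if j < i then i - 1 - j else j)) 0 := by
        simp [h2]
      constructor
      · rw [← hcardI, hz0]
        exact hdeg _ hrot
      · rw [← hLcard]
        have : k - L.card ≥ (X \ L).card := by
          rw [Finset.card_sdiff_of_subset hLX]; omega
        refine le_trans (degIn_le_of_subset fun u hu ha => ?_) this
        rw [Finset.mem_sdiff] at hu ⊢
        refine ⟨?_, hu.2⟩
        rw [hz0] at ha
        obtain ⟨j, hj0, hjp, rfl⟩ := hrot.mem_of_longest hp hmax hu.1 ha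
        rw [hX, Finset.mem_image]
        refine ⟨_, ?_, rfl⟩
        rw [Finset.mem_range, lt_min_iff]
        have hjk : j + 1 ≤ k := by
          by_cases h5 : 2 ≤ j
          · exact hc _ _ (hrot.toCycle hjp h5 ha)
          · omega
        constructor <;> split_ifs <;> omega
    have hcard : (W \ L).card = W.card - I.card := by
      rw [Finset.card_sdiff_of_subset hLW, hLcard]
    have hpos : 0 < (W \ L).card := Finset.card_pos.2 ⟨_, hlast⟩
    have h1 := ih (W \ L) (Finset.sdiff_ssubset hLW
      (Finset.card_pos.1 (by omega))) ⟨_, hlast⟩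
      (fun c u hu => hc c u (hu.mono fun i hi => (Finset.mem_sdiff.1 (hu.mem i hi)).1))
    have hIk' : I.card ≤ k := by
      rw [← hLcard]; exact (Finset.card_le_card hLX).trans hXcard
    have h2 : ∑ z ∈ L, (degIn G W z + degIn G (W \ L) z) ≤ ∑ z ∈ L, k :=
      Finset.sum_le_sum fun z hz => by have := hbound z hz; omega
    rw [Finset.sum_const, smul_eq_mul, hLcard] at h2
    rw [degSum_sdiff hLW]
    calc _ ≤ k * ((W \ L).card - 1) + I.card * k := Nat.add_le_add h1 h2
      _ = k * ((W \ L).card - 1 + I.card) := by ring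
      _ = k * (W.card - 1) := by
        congr 1; omega

end Paths

/-! ### Hamiltonian and pancyclic dense subgraphs. -/

section Cycles

variable {V : Type*} {G : SimpleGraph V} {W : Finset V}

theorem IsCycleSeq.shift {c s : ℕ} {v : ℕ → V} (h : IsCycleSeq G W c v) (hs : s < c) :
    IsCycleSeq G W c (fun i => v (if i + s < c then i + s else i + s - c)) where
  inj a b hap hb e := by
    have := h.inj _ _ (by split_ifs <;> omega) (by split_ifs <;> omega) e
    split_ifs at this <;> omega
  mem a hap := h.mem _ (by split_ifs <;> omega)
  adj a hap := by
    rcases lt_trichotomy (a + 1 + s) c with h1 | h1 | h1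
    · have := h.adj (a + s) (by omega)
      rw [show a + s + 1 = a + 1 + s by omega] at this
      simpa only [h1, show a + s < c by omega, if_true] using this
    · have h2 : a + s = c - 1 := by omega
      simpa [h1, show a + s < c by omega, h2, show c - 1 < c by omega] using h.close
    · have := h.adj (a + s - c) (by omega)
      rw [show a + s - c + 1 = a + 1 + s - c by omega] at this
      simpa [show ¬ a + s < c by omega, show ¬ a + 1 + s < c by omega] using this
  three_le := h.three_le
  close := by
    have h3 := h.three_le
    rcases Nat.eq_zero_or_pos s with h0 | h0
    · subst h0
      simpa [show c - 1 < c by omega, show 0 < c by omega] using h.close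
    · have := h.adj (s - 1) (by omega)
      rw [show s - 1 + 1 = s by omega] at this
      simpa [show ¬ c - 1 + s < c by omega, hs, show c - 1 + s - c = s - 1 by omega] using this

/-- Two disjoint paths whose ends are joined crosswise form a cycle. -/
theorem IsPathSeq.append_close {p q : ℕ} {u v : ℕ → V} (hu : IsPathSeq G W p u)
    (hv : IsPathSeq G W q v) (hp : 0 < p) (hq : 0 < q) (h3 : 3 ≤ p + q)
    (hdis : ∀ i j, i < p → j < q → u i ≠ v j) (h1 : G.Adj (u (p - 1)) (v 0))
    (h2 : G.Adj (v (q - 1)) (u 0)) :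
    IsCycleSeq G W (p + q) (fun i => if i < p then u i else v (i - p)) where
  inj a b hap hb e := by
    by_cases ha : a < p <;> by_cases hb' : b < p
    · simp only [ha, hb', if_true] at e
      exact hu.inj _ _ ha hb' e
    · simp only [ha, hb', if_true, if_false] at e
      exact absurd e (hdis _ _ ha (by omega))
    · simp only [ha, hb', if_true, if_false] at e
      exact absurd e.symm (hdis _ _ hb' (by omega))
    · simp only [ha, hb', if_false] at e
      have := hv.inj _ _ (by omega) (by omega) e
      omega
  mem a hap := by
    by_cases ha : a < p
    · simpa [ha] using hu.mem a ha
    · simpa [ha] using hv.mem (a - p) (by omega)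
  adj a hap := by
    rcases lt_trichotomy (a + 1) p with h | h | h
    · simpa [h, show a < p by omega] using hu.adj a h
    · have e : a = p - 1 := by omega
      subst e
      simpa [show p - 1 < p by omega, h] using h1
    · have := hv.adj (a - p) (by omega)
      rw [show a - p + 1 = a + 1 - p by omega] at this
      simpa [show ¬ a < p by omega, show ¬ a + 1 < p by omega] using this
  three_le := h3
  close := by
    simpa [show ¬ p + q - 1 < p by omega, hp, show p + q - 1 - p = q - 1 by omega] using h2

theorem IsPathSeq.drop {p s q : ℕ} {v : ℕ → V} (h : IsPathSeq G W p v) (hs : s + q ≤ p) :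
    IsPathSeq G W q (fun i => v (i + s)) where
  inj a b hap hb e := by
    have := h.inj _ _ (by omega) (by omega) e
    omega
  mem a hap := h.mem _ (by omega)
  adj a hap := by
    have := h.adj (a + s) (by omega)
    rwa [show a + s + 1 = a + 1 + s by omega] at this

theorem IsPathSeq.take {p q : ℕ} {v : ℕ → V} (h : IsPathSeq G W p v) (hs : q ≤ p) :
    IsPathSeq G W q v :=
  h.drop (s := 0) (by omega)

theorem IsPathSeq.injOn {c : ℕ} {v : ℕ → V} (h : IsPathSeq G W c v) :
    Set.InjOn v (Finset.range c) := fun i hi j hj e =>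
  h.inj i j (by simpa using hi) (by simpa using hj) e

open Classical in
theorem IsPathSeq.degIn_image {c : ℕ} {v : ℕ → V} (h : IsPathSeq G W c v) (x : V) :
    degIn G ((Finset.range c).image v) x =
      ((Finset.range c).filter (fun i => G.Adj x (v i))).card := by
  unfold degIn
  rw [Finset.filter_image, Finset.card_image_of_injOn]
  exact h.injOn.mono fun i hi => (Finset.mem_filter.1 hi).1

/-- Bondy: a Hamiltonian cycle with two consecutive vertices of degree sum at least `c + 1`
yields cycles of all lengths. -/
theorem IsCycleSeq.exists_of_degree {c l : ℕ} {v : ℕ → V} (h : IsCycleSeq G W c v)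
    (hl : 3 ≤ l) (hlc : l ≤ c) (hW : ∀ x ∈ W, ∃ i < c, v i = x)
    (hd : c + 1 ≤ degIn G W (v 0) + degIn G W (v (c - 1))) :
    ∃ u, IsCycleSeq G W l u := by
  classical
  by_cases hlc' : l = c
  · exact ⟨v, hlc' ▸ h⟩
  by_contra hno
  have hWeq : W = (Finset.range c).image v := by
    ext x
    simp only [Finset.mem_image, Finset.mem_range]
    exact ⟨fun hx => hW x hx, fun ⟨i, hi, e⟩ => e ▸ h.mem i hi⟩
  have hdeg : ∀ x, degIn G W x = ((Finset.range c).filter (fun i => G.Adj x (v i))).card := by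
    intro x
    have := h.degIn_image x
    rwa [← hWeq] at this
  -- A chord from `v 0` to `v j` and one from `v (c - 1)` to `v (φ j)` close a cycle of length `l`:
  -- through the arc from `j` to `φ j` and the edge `v (c - 1) v 0` if `j` is small, and otherwise
  -- by skipping the `c - l` vertices between `φ j` and `j`. As `φ` is injective on `[1, c - 2]`
  -- into itself, avoiding all such pairs forces degree sum at most `c`.
  set φ : ℕ → ℕ := fun j => if j ≤ c - l + 1 then j + l - 3 else j - (c - l) - 1 with hφ
  have key : ∀ j, 1 ≤ j → j ≤ c - 2 → G.Adj (v 0) (v j) →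
      ¬ G.Adj (v (c - 1)) (v (φ j)) := by
    intro j hj1 hj2 ha hb
    apply hno
    by_cases hj : j ≤ c - l + 1
    · simp only [hφ, hj, if_true] at hb
      have p1 := h.toIsPathSeq.drop (s := j) (q := l - 2) (by omega)
      have p2 : IsPathSeq G W 2 (fun i => if i = 0 then v (c - 1) else v 0) := by
        refine ⟨fun a b h1 h2 e => ?_, fun a _ => ?_, fun a h1 => ?_⟩
        · by_cases ha0 : a = 0 <;> by_cases hb0 : b = 0
          · omega
          · simp only [ha0, hb0, if_true, if_false] at e
            have := h.inj _ _ (by omega) (by omega) e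
            omega
          · simp only [ha0, hb0, if_true, if_false] at e
            have := h.inj _ _ (by omega) (by omega) e
            omega
          · omega
        · split_ifs
          · exact h.mem _ (by omega)
          · exact h.mem _ (by omega)
        · have : a = 0 := by omega
          subst this
          simpa using h.close
      have := p1.append_close p2 (by omega) (by omega) (by omega) (fun a b h1 h2 e => by
        split_ifs at e
        · have := h.inj _ _ (by omega) (by omega) e
          omega
        · have := h.inj _ _ (by omega) (by omega) e
          omega) (by
          rw [show j + l - 3 = l - 2 - 1 + j by omega] at hb
          simpa using hb.symm) (by simpa using ha)
      rw [show l - 2 + 2 = l by omega] at this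
      exact ⟨_, this⟩
    · simp only [hφ, hj, if_false] at hb
      have p1 := h.toIsPathSeq.take (q := j - (c - l)) (by omega)
      have p2 := (h.toIsPathSeq.drop (s := j) (q := c - j) (by omega)).reverse
      have := p1.append_close p2 (by omega) (by omega) (by omega) (fun a b h1 h2 e => by
        have := h.inj _ _ (by omega) (by omega) e
        omega) (by
          rw [show c - j - 1 - 0 + j = c - 1 by omega]
          exact hb.symm) (by
          rw [show c - j - 1 - (c - j - 1) + j = j by omega]
          exact ha.symm)
      rw [show j - (c - l) + (c - j) = l by omega] at this
      exact ⟨_, this⟩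
  set J := (Finset.Icc 1 (c - 2)).filter (fun j => G.Adj (v 0) (v j)) with hJ
  set J' := (Finset.Icc 1 (c - 2)).filter (fun j => G.Adj (v (c - 1)) (v j)) with hJ'
  have h1 : degIn G W (v 0) ≤ J.card + 1 := by
    rw [hdeg]
    refine le_trans (Finset.card_le_card ?_) (Finset.card_insert_le (c - 1) J)
    intro j hj
    rw [Finset.mem_filter, Finset.mem_range] at hj
    rw [Finset.mem_insert, hJ, Finset.mem_filter, Finset.mem_Icc]
    have : j ≠ 0 := by rintro rfl; exact hj.2.ne rfl
    by_cases h4 : j = c - 1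
    · exact Or.inl h4
    · exact Or.inr ⟨by omega, hj.2⟩
  have h2 : degIn G W (v (c - 1)) ≤ J'.card + 1 := by
    rw [hdeg]
    refine le_trans (Finset.card_le_card ?_) (Finset.card_insert_le 0 J')
    intro j hj
    rw [Finset.mem_filter, Finset.mem_range] at hj
    rw [Finset.mem_insert, hJ', Finset.mem_filter, Finset.mem_Icc]
    have : j ≠ c - 1 := by rintro rfl; exact hj.2.ne rfl
    by_cases h4 : j = 0
    · exact Or.inl h4
    · exact Or.inr ⟨by omega, hj.2⟩
  have h3 : (J.image φ).card = J.card := by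
    apply Finset.card_image_of_injOn
    intro a ha b hb e
    have ha' := Finset.mem_Icc.1 (Finset.mem_filter.1 ha).1
    have hb' := Finset.mem_Icc.1 (Finset.mem_filter.1 hb).1
    simp only [hφ] at e
    split_ifs at e <;> omega
  have h4 : Disjoint (J.image φ) J' := by
    rw [Finset.disjoint_left]
    intro x hx hx'
    rw [Finset.mem_image] at hx
    obtain ⟨j, hj, rfl⟩ := hx
    have hj1 := Finset.mem_Icc.1 (Finset.mem_filter.1 hj).1
    exact key j hj1.1 hj1.2 (Finset.mem_filter.1 hj).2 (Finset.mem_filter.1 hx').2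
  have h5 : (J.image φ ∪ J').card ≤ (Finset.Icc 1 (c - 2)).card := by
    apply Finset.card_le_card
    intro x hx
    rw [Finset.mem_union] at hx
    rcases hx with hx | hx
    · rw [Finset.mem_image] at hx
      obtain ⟨j, hj, rfl⟩ := hx
      have hj1 := Finset.mem_Icc.1 (Finset.mem_filter.1 hj).1
      rw [Finset.mem_Icc]
      simp only [hφ]
      split_ifs <;> omega
    · exact (Finset.mem_filter.1 hx).1
  rw [Finset.card_union_of_disjoint h4, h3, Nat.card_Icc] at h5
  omega

/-- A dense graph with a Hamiltonian cycle has cycles of all lengths. -/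
theorem IsCycleSeq.pancyclic {c l : ℕ} {v : ℕ → V} (h : IsCycleSeq G W c v)
    (hl : 3 ≤ l) (hlc : l ≤ c) (hW : ∀ x ∈ W, ∃ i < c, v i = x)
    (hd : c ^ 2 < 2 * degSum G W) : ∃ u, IsCycleSeq G W l u := by
  classical
  have h3 := h.three_le
  have hWeq : W = (Finset.range c).image v := by
    ext x
    simp only [Finset.mem_image, Finset.mem_range]
    exact ⟨fun hx => hW x hx, fun ⟨i, hi, e⟩ => e ▸ h.mem i hi⟩
  have hsum : degSum G W = ∑ i ∈ Finset.range c, degIn G W (v i) := by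
    unfold degSum
    conv_lhs => rw [hWeq, Finset.sum_image h.injOn]
    rw [← hWeq]
  by_contra hno
  have hsmall : ∀ s < c, degIn G W (v s) +
      degIn G W (v (if s = 0 then c - 1 else s - 1)) ≤ c := by
    intro s hs
    by_contra hcon
    apply hno
    have hsh := h.shift hs
    refine hsh.exists_of_degree hl hlc (fun x hx => ?_) ?_
    · obtain ⟨i, hi, rfl⟩ := hW x hx
      refine ⟨if s ≤ i then i - s else i + c - s, by split_ifs <;> omega, ?_⟩
      congr 1
      split_ifs <;> omega
    · have e1 : (if 0 + s < c then 0 + s else 0 + s - c) = s := by split_ifs <;> omega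
      have e2 : (if c - 1 + s < c then c - 1 + s else c - 1 + s - c) =
        (if s = 0 then c - 1 else s - 1) := by split_ifs <;> omega
      rw [e1, e2]
      omega
  -- Summed around the cycle, each degree occurs in two consecutive pairs, which gives `2 * degSum G
  -- W ≤ c ^ 2`.
  have hle := Finset.sum_le_sum fun s hs => hsmall s (Finset.mem_range.1 hs)
  rw [Finset.sum_add_distrib, ← hsum, Finset.sum_const, Finset.card_range, smul_eq_mul] at hle
  have hshift : ∑ i ∈ Finset.range c, degIn G W (v (if i = 0 then c - 1 else i - 1)) =
      degSum G W := by
    rw [hsum]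
    obtain ⟨c', rfl⟩ : ∃ c', c = c' + 1 := ⟨c - 1, by omega⟩
    rw [Finset.sum_range_succ', Finset.sum_range_succ]
    simp
  rw [hshift] at hle
  nlinarith

/-- A set of integers in an interval without two consecutive elements. -/
theorem two_mul_card_le_of_no_consecutive {S : Finset ℕ} {a b : ℕ}
    (hS : ∀ i ∈ S, a ≤ i ∧ i < b) (hc : ∀ i ∈ S, i + 1 ∉ S) : 2 * S.card ≤ b + 1 - a := by
  classical
  have h1 : Disjoint S (S.image (· + 1)) := by
    rw [Finset.disjoint_right]
    intro x hx
    rw [Finset.mem_image] at hx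
    obtain ⟨i, hi, rfl⟩ := hx
    exact hc i hi
  have h2 : (S ∪ S.image (· + 1)).card ≤ (Finset.Ico a (b + 1)).card := by
    apply Finset.card_le_card
    intro x hx
    rw [Finset.mem_union, Finset.mem_image] at hx
    rw [Finset.mem_Ico]
    rcases hx with hx | ⟨i, hi, rfl⟩
    · have := hS x hx; omega
    · have := hS i hi; omega
  rw [Finset.card_union_of_disjoint h1, Finset.card_image_of_injective _ (add_left_injective 1),
    Nat.card_Ico] at h2
  omega

/-- Neighbours on a longest cycle of the start of a path whose end is attached to the cycle. -/
theorem IsCycleSeq.two_mul_card_attached_le {c q : ℕ} {v x : ℕ → V} (h : IsCycleSeq G W c v)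
    (hmax : ∀ q u, IsCycleSeq G W q u → q ≤ c) (hx : IsPathSeq G W q x) (hq : 0 < q)
    (hdis : ∀ i j, i < q → j < c → x i ≠ v j) (hend : G.Adj (x (q - 1)) (v 0))
    {S : Finset ℕ} (hS : ∀ i ∈ S, 0 < i ∧ i < c ∧ G.Adj (x 0) (v i)) :
    2 * S.card ≤ c - 2 * q := by
  have h3 := h.three_le
  -- Were `i` within cyclic distance `q` of `0`, replacing the shorter arc by the `q` vertices of
  -- `x` would lengthen the cycle.
  have hfar : ∀ i ∈ S, q + 1 ≤ i ∧ i < c - q := by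
    intro i hi
    obtain ⟨hi0, hic, ha⟩ := hS i hi
    constructor
    · have p2 := (h.toIsPathSeq.drop (s := i) (q := c - i) (by omega))
      have p3 : IsPathSeq G W (c - i + 1)
          (fun j => if j = 0 then v 0 else v (c - 1 - (j - 1))) := by
        have := p2.reverse.cons (u := v 0) (h.mem 0 (by omega)) (by omega)
          (fun a h1 e => by
            have := h.inj _ _ (by omega) (by omega) e
            omega) (by
              rw [show c - i - 1 - 0 + i = c - 1 by omega]
              exact h.close.symm)
        refine ⟨fun a b h1 h2 e => this.inj a b h1 h2 ?_, fun a h1 => ?_, fun a h1 => ?_⟩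
        · have e1 : ∀ a, a ≠ 0 → a < c - i + 1 →
            c - i - 1 - (a - 1) + i = c - 1 - (a - 1) := by intros; omega
          by_cases ha0 : a = 0 <;> by_cases hb0 : b = 0 <;>
            simp only [ha0, hb0, if_true, if_false] at e ⊢
          · rw [e1 b hb0 h2]; exact e
          · rw [e1 a ha0 h1]; exact e
          · rw [e1 b hb0 h2, e1 a ha0 h1]; exact e
        · split_ifs
          · exact h.mem _ (by omega)
          · exact h.mem _ (by omega)
        · have := this.adj a h1
          simp only [Nat.add_eq_zero_iff, one_ne_zero, and_false, if_false] at this ⊢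
          rw [show c - i - 1 - (a + 1 - 1) + i = c - 1 - (a + 1 - 1) by omega] at this
          split_ifs at this ⊢
          · exact this
          · rwa [show c - i - 1 - (a - 1) + i = c - 1 - (a - 1) by omega] at this
      have := hmax _ _ (hx.append_close p3 hq (by omega) (by omega) (fun a b h1 h2 => by
        split_ifs
        · exact hdis _ _ h1 (by omega)
        · exact hdis _ _ h1 (by omega)) (by simpa using hend) (by
          have e : c - 1 - (c - i - 1) = i := by omega
          simpa [show c - i ≠ 0 by omega, e] using ha.symm))
      omega
    · have := hmax _ _ (hx.append_close (h.toIsPathSeq.take (q := i + 1) (by omega)) hq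
        (by omega) (by omega) (fun a b h1 h2 => hdis a b h1 (by omega)) hend
        (by simpa using ha.symm))
      omega
  -- If `x 0` were adjacent to two consecutive vertices of the cycle, it could be inserted between
  -- them.
  refine le_trans (two_mul_card_le_of_no_consecutive hfar fun i hi hi' => ?_) (by omega)
  obtain ⟨hi0, hic, ha⟩ := hS i hi
  obtain ⟨-, hic', ha'⟩ := hS _ hi'
  have hsh := h.shift hic'
  have p1 : IsPathSeq G W 1 x := hx.take (by omega)
  have := hmax _ _ (p1.append_close hsh.toIsPathSeq (by omega) (by omega) (by omega)
    (fun a b h1 h2 => hdis _ _ (by omega) (by split_ifs <;> omega))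
    (by
      have e : (if 0 + (i + 1) < c then 0 + (i + 1) else 0 + (i + 1) - c) = i + 1 := by
        split_ifs <;> omega
      rw [e]
      exact ha')
    (by
      have e : (if c - 1 + (i + 1) < c then c - 1 + (i + 1) else c - 1 + (i + 1) - c) = i := by
        split_ifs <;> omega
      rw [e]
      exact ha.symm))
  omega

open Classical in
/-- A longest cycle of length more than half the order cannot miss a set of vertices all of
which have large degree. -/
theorem IsCycleSeq.hamiltonian_of_degree {c : ℕ} {v : ℕ → V} (h : IsCycleSeq G W c v)
    (hmax : ∀ q u, IsCycleSeq G W q u → q ≤ c) (hcW : W.card < 2 * c)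
    (hdeg : ∀ x ∈ W \ (Finset.range c).image v, W.card ≤ 2 * degIn G W x) :
    ∀ x ∈ W, ∃ i < c, v i = x := by
  set C := (Finset.range c).image v with hC
  have h3 := h.three_le
  have hCW : C ⊆ W := by
    intro x hx
    rw [hC, Finset.mem_image] at hx
    obtain ⟨i, hi, rfl⟩ := hx
    exact h.mem i (Finset.mem_range.1 hi)
  have hCcard : C.card = c := by
    rw [hC, Finset.card_image_of_injOn h.injOn, Finset.card_range]
  by_contra hcon
  have hR : (W \ C).Nonempty := by
    push Not at hcon
    obtain ⟨x, hx, hx'⟩ := hcon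
    refine ⟨x, Finset.mem_sdiff.2 ⟨hx, fun hxC => ?_⟩⟩
    rw [hC, Finset.mem_image] at hxC
    obtain ⟨i, hi, e⟩ := hxC
    exact hx' i (Finset.mem_range.1 hi) e
  have hRcard : (W \ C).card = W.card - c := by
    rw [Finset.card_sdiff_of_subset hCW, hCcard]
  have hcle : c ≤ W.card := hCcard ▸ Finset.card_le_card hCW
  obtain ⟨q, x, hq, hx, hxmax⟩ := exists_longest_path (G := G) hR
  have hqR := hx.card_le
  have hsplit : ∀ z, degIn G W z = degIn G (W \ C) z + degIn G C z := fun z => by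
    rw [← degIn_union Finset.sdiff_disjoint, Finset.sdiff_union_of_subset hCW]
  -- Either end of a longest path off the cycle has at most `q - 1` neighbours off the cycle, so the
  -- rest of its degree goes into `C`. Since `q ≤ W.card - c < W.card / 2`, this leaves at least one
  -- neighbour there.
  have hstart : ∀ y, IsPathSeq G (W \ C) q y → W.card + 2 ≤ 2 * degIn G C (y 0) + 2 * q := by
    intro y hy
    have h1 := hdeg _ (hy.mem 0 hq)
    rw [hsplit] at h1
    have h2 : degIn G (W \ C) (y 0) ≤ q - 1 := by
      refine le_trans (degIn_le_of_subset (X := (Finset.Ico 1 q).image y) fun u hu ha => ?_)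
        (Finset.card_image_le.trans (by simp))
      obtain ⟨i, hi0, hiq, rfl⟩ := hy.mem_of_longest hq hxmax hu ha
      exact Finset.mem_image_of_mem _ (Finset.mem_Ico.2 ⟨hi0, hiq⟩)
    omega
  have hA := hstart x hx
  have hB := hstart _ hx.reverse
  obtain ⟨s, hs, hadj⟩ : ∃ s < c, G.Adj (x (q - 1)) (v s) := by
    have : 0 < degIn G C (x (q - 1 - 0)) := by omega
    rw [hC, h.degIn_image, Finset.card_pos] at this
    obtain ⟨s, hs⟩ := this
    rw [Finset.mem_filter, Finset.mem_range] at hs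
    exact ⟨s, hs.1, hs.2⟩
  -- The cycle is shifted so that the far end of the path attaches at index `0`. The count of
  -- attached neighbours excludes that index, which costs one in `hcard`.
  have hsh := h.shift hs
  set w : ℕ → V := fun i => v (if i + s < c then i + s else i + s - c) with hw
  have hwC : (Finset.range c).image w = C := by
    apply Finset.eq_of_subset_of_card_le
    · intro y hy
      rw [Finset.mem_image] at hy
      obtain ⟨i, hi, rfl⟩ := hy
      rw [Finset.mem_range] at hi
      exact Finset.mem_image_of_mem _ (Finset.mem_range.2 (by split_ifs <;> omega))
    · rw [Finset.card_image_of_injOn hsh.injOn, Finset.card_range, hCcard]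
  set A := (Finset.range c).filter (fun i => G.Adj (x 0) (w i)) with hAdef
  have hAcard : degIn G C (x 0) = A.card := by
    rw [← hwC, hsh.degIn_image]
  have hS := hsh.two_mul_card_attached_le (q := q) (x := x) hmax
    (hx.mono fun i hi => (Finset.mem_sdiff.1 (hx.mem i hi)).1) hq
    (fun i j hi hj e => by
      apply (Finset.mem_sdiff.1 (hx.mem i hi)).2
      rw [e, ← hwC]
      exact Finset.mem_image_of_mem _ (Finset.mem_range.2 hj))
    (by
      have e : (if 0 + s < c then 0 + s else 0 + s - c) = s := by split_ifs <;> omega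
      simp only [hw, e]
      exact hadj)
    (S := A.erase 0) (fun i hi => by
      rw [Finset.mem_erase, hAdef, Finset.mem_filter, Finset.mem_range] at hi
      exact ⟨by omega, hi.2.1, hi.2.2⟩)
  have hcard : A.card ≤ (A.erase 0).card + 1 := by
    have := Finset.pred_card_le_card_erase (s := A) (a := 0)
    omega
  omega

/-- A graph on `2m - 1` vertices of average degree at least `m` has cycles of all lengths
from `3` to `m + 1`. -/
theorem exists_cycle_of_degSum {m l : ℕ} (hm : 2 ≤ m) (hl : 3 ≤ l) (hlm : l ≤ m + 1)
    (W₀ : Finset V) (hcard : W₀.card = 2 * m - 1) (hsum : m * (2 * m - 1) ≤ degSum G W₀) :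
    ∃ u, IsCycleSeq G W₀ l u := by
  classical
  -- If all cycles had length at most `m`, the Erdős–Gallai bound would be `m * (2 * m - 2)`.
  obtain ⟨c₀, v₀, hc₀, hv₀⟩ : ∃ c v, m + 1 ≤ c ∧ IsCycleSeq G W₀ c v := by
    by_contra hcon
    push Not at hcon
    have := degSum_le_of_cycles_le (G := G) hm W₀ (Finset.card_pos.1 (by omega))
      (fun c v hv => by
        by_contra h1
        exact hcon c v (by omega) hv)
    rw [hcard] at this
    have h2 := hsum.trans this
    have := Nat.le_of_mul_le_mul_left h2 (by omega)
    omega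
  -- A smallest subset that still has more than a quarter of its squared order in edges and a cycle
  -- longer than `m`. A vertex off the longest cycle with degree below half the order could be
  -- deleted while keeping both properties, so `hamiltonian_of_degree` applies.
  let P : ℕ → Prop := fun w => ∃ W ⊆ W₀, W.card = w ∧ W.card ^ 2 < 2 * degSum G W ∧
    ∃ c v, m + 1 ≤ c ∧ IsCycleSeq G W c v
  have hP : ∃ w, P w := by
    refine ⟨_, W₀, Finset.Subset.refl _, rfl, ?_, c₀, v₀, hc₀, hv₀⟩
    rw [hcard]
    obtain ⟨n, hn⟩ : ∃ n, n = 2 * m - 1 := ⟨_, rfl⟩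
    rw [← hn] at hsum ⊢
    have : 2 * m = n + 1 := by omega
    nlinarith
  obtain ⟨W, hWW, hWc, hWd, c₁, v₁, hc₁, hv₁⟩ := Nat.find_spec hP
  have hmin := fun w (hw : w < Nat.find hP) => Nat.find_min hP hw
  obtain ⟨c, v, hcc, hv, hmax⟩ := exists_longest_cycle hv₁
  have hWle : W.card ≤ 2 * m - 1 := hcard ▸ Finset.card_le_card hWW
  have hham := hv.hamiltonian_of_degree hmax (by omega) (fun x hx => by
    rw [Finset.mem_sdiff] at hx
    by_contra hlow
    have hpos : 0 < W.card := Finset.card_pos.2 ⟨x, hx.1⟩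
    apply hmin (W.erase x).card
      (by rw [Finset.card_erase_of_mem hx.1]; omega)
    refine ⟨W.erase x, (Finset.erase_subset _ _).trans hWW, rfl, ?_, c, v, by omega,
      hv.mono fun i hi => Finset.mem_erase.2 ⟨fun e => hx.2 ?_, hv.mem i hi⟩⟩
    · rw [degSum_erase hx.1] at hWd
      rw [Finset.card_erase_of_mem hx.1]
      obtain ⟨w, hw⟩ : ∃ w, W.card = w + 1 := ⟨W.card - 1, by omega⟩
      rw [hw] at hWd hlow ⊢
      simp only [Nat.add_sub_cancel]
      nlinarith
    · rw [← e]
      exact Finset.mem_image_of_mem _ (Finset.mem_range.2 hi))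
  have hWc' : W.card = c := by
    apply le_antisymm _ hv.card_le
    have : W ⊆ (Finset.range c).image v := fun x hx => by
      obtain ⟨i, hi, rfl⟩ := hham x hx
      exact Finset.mem_image_of_mem _ (Finset.mem_range.2 hi)
    exact (Finset.card_le_card this).trans (Finset.card_image_le.trans (by simp))
  obtain ⟨u, hu⟩ := hv.pancyclic hl (by omega) hham (by rw [← hWc']; exact hWd)
  exact ⟨u, hu.mono fun i hi => hWW (hu.mem i hi)⟩

end Cycles

/-! ### Books in graphs with more than `n ^ 2 / 4` edges. -/

section Books

open Finset in
/-- Summing the inclusion-exclusion inequality over all triangles of a graph with adjacency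
indicator `A`, degrees `d` and codegrees `c`. -/
theorem sum_triangle_inequality {V : Type*} (W : Finset V) (A : V → V → ℤ)
    (h01 : ∀ u v, A u v = 0 ∨ A u v = 1) (hsymm : ∀ u v, A u v = A v u)
    {c : V → V → ℤ} {d : V → ℤ} (hc : ∀ u v, c u v = ∑ x ∈ W, A u x * A v x)
    (hd : ∀ u, d u = ∑ x ∈ W, A u x) :
    3 * ∑ u ∈ W, ∑ v ∈ W, A u v * c u v * d u ≤
      W.card * ∑ u ∈ W, ∑ v ∈ W, A u v * c u v +
      3 * ∑ u ∈ W, ∑ v ∈ W, A u v * c u v * c u v := by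
  have hcs : ∀ u v, c u v = c v u := fun u v => by
    rw [hc, hc]; exact sum_congr rfl fun x _ => mul_comm _ _
  -- Each `x` adjacent to `i` of the three vertices adds `i` on the left and `1 + i.choose 2` on the
  -- right.
  have hpt : ∀ u v w, d u + d v + d w ≤ W.card + (c u v + c v w + c u w) := by
    intro u v w
    rw [hd, hd, hd, hc, hc, hc, card_eq_sum_ones]
    push_cast
    simp only [← sum_add_distrib]
    refine sum_le_sum fun x _ => ?_
    rcases h01 u x with h1 | h1 <;> rcases h01 v x with h2 | h2 <;>
      rcases h01 w x with h3 | h3 <;> rw [h1, h2, h3] <;> norm_num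
  have hT : ∀ u v w, 0 ≤ A u v * (A u w * A v w) := by
    intro u v w
    rcases h01 u v with h1 | h1 <;> rcases h01 u w with h2 | h2 <;>
      rcases h01 v w with h3 | h3 <;> rw [h1, h2, h3] <;> norm_num
  have hsum : ∑ u ∈ W, ∑ v ∈ W, ∑ w ∈ W, A u v * (A u w * A v w) * (d u + d v + d w) ≤
      ∑ u ∈ W, ∑ v ∈ W, ∑ w ∈ W,
        A u v * (A u w * A v w) * (W.card + (c u v + c v w + c u w)) :=
    sum_le_sum fun u _ => sum_le_sum fun v _ => sum_le_sum fun w _ =>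
      mul_le_mul_of_nonneg_left (hpt u v w) (hT u v w)
  have r1 : ∀ f : V → V → ℤ,
      ∑ u ∈ W, ∑ v ∈ W, ∑ w ∈ W, A u v * (A u w * A v w) * f u v =
        ∑ u ∈ W, ∑ v ∈ W, A u v * c u v * f u v := by
    intro f
    refine sum_congr rfl fun u _ => sum_congr rfl fun v _ => ?_
    rw [hc, ← sum_mul, ← mul_sum]
  have r2 : ∀ f : V → V → ℤ,
      ∑ u ∈ W, ∑ v ∈ W, ∑ w ∈ W, A u v * (A u w * A v w) * f u w =
        ∑ u ∈ W, ∑ v ∈ W, A u v * c u v * f u v := by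
    intro f
    rw [← r1]
    refine sum_congr rfl fun u _ => ?_
    rw [sum_comm]
    refine sum_congr rfl fun v _ => sum_congr rfl fun w _ => ?_
    rw [hsymm w v]; ring
  have r3 : ∀ f : V → V → ℤ,
      ∑ u ∈ W, ∑ v ∈ W, ∑ w ∈ W, A u v * (A u w * A v w) * f v w =
        ∑ u ∈ W, ∑ v ∈ W, A u v * c u v * f u v := by
    intro f
    rw [← r2 f, sum_comm]
    refine sum_congr rfl fun v _ => sum_congr rfl fun u _ => sum_congr rfl fun w _ => ?_
    rw [hsymm u v]; ring
  have hswap : ∑ u ∈ W, ∑ v ∈ W, A u v * c u v * d v = ∑ u ∈ W, ∑ v ∈ W, A u v * c u v * d u := by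
    rw [sum_comm]
    refine sum_congr rfl fun v _ => sum_congr rfl fun u _ => ?_
    rw [hsymm u v, hcs u v]
  simp only [mul_add, sum_add_distrib] at hsum
  rw [r1 (fun u _ => d u), r1 (fun _ v => d v), r2 (fun _ w => d w), r1 (fun _ _ => (W.card : ℤ)),
    r1 c, r3 c, r2 c, hswap] at hsum
  have : ∑ u ∈ W, ∑ v ∈ W, A u v * c u v * (W.card : ℤ) =
      W.card * ∑ u ∈ W, ∑ v ∈ W, A u v * c u v := by
    simp only [← sum_mul]; ring
  linarith

open Finset in
/-- Edwards, Khadžiivanov and Nikiforov: a graph of order `n` with more than `n ^ 2 / 4` edges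
has two adjacent vertices with more than `n / 6` common neighbours. -/
theorem exists_large_codegree {V : Type*} (W : Finset V) (A : V → V → ℤ)
    (h01 : ∀ u v, A u v = 0 ∨ A u v = 1) (hsymm : ∀ u v, A u v = A v u)
    (hdense : (W.card : ℤ) ^ 2 < 2 * ∑ u ∈ W, ∑ v ∈ W, A u v) :
    ∃ u ∈ W, ∃ v ∈ W, A u v = 1 ∧ (W.card : ℤ) < 6 * ∑ x ∈ W, A u x * A v x := by
  by_contra hcon
  push Not at hcon
  set n : ℤ := (W.card : ℤ) with hn
  obtain ⟨c, hc⟩ : ∃ c : V → V → ℤ, ∀ u v, c u v = ∑ x ∈ W, A u x * A v x := ⟨_, fun _ _ => rfl⟩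
  obtain ⟨d, hd⟩ : ∃ d : V → ℤ, ∀ u, d u = ∑ x ∈ W, A u x := ⟨_, fun _ => rfl⟩
  simp only [← hc] at hcon
  simp only [← hd] at hdense
  have htri := sum_triangle_inequality W A h01 hsymm hc hd
  have hcs : ∀ u v, c u v = c v u := fun u v => by
    rw [hc, hc]; exact sum_congr rfl fun x _ => mul_comm _ _
  have hc0 : ∀ u v, 0 ≤ c u v := fun u v => by
    rw [hc]
    refine sum_nonneg fun x _ => ?_
    rcases h01 u x with h1 | h1 <;> rcases h01 v x with h2 | h2 <;> rw [h1, h2] <;> norm_num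
  have hpair : ∀ u v, d u + d v ≤ n + c u v := by
    intro u v
    rw [hd, hd, hc, hn, card_eq_sum_ones]
    push_cast
    simp only [← sum_add_distrib]
    refine sum_le_sum fun x _ => ?_
    rcases h01 u x with h1 | h1 <;> rcases h01 v x with h2 | h2 <;> rw [h1, h2] <;> norm_num
  -- On an edge, with `c = c u v`, this is the sum of `0 ≤ (n - 6 * c) * (n + c - d u - d v)` and `0
  -- ≤ c * (n - 6 * c)`. The coefficients make the summed right side four times the difference
  -- bounded in `sum_triangle_inequality`, hence nonpositive.
  have hpt : ∀ u ∈ W, ∀ v ∈ W,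
      A u v * (n * (d u + d v - n)) ≤
        A u v * (6 * (c u v * (d u + d v)) - 12 * (c u v * c u v) - 4 * (n * c u v)) := by
    intro u hu v hv
    rcases h01 u v with h1 | h1
    · rw [h1]; norm_num
    · rw [h1]
      have h2 := hcon u hu v hv h1
      have h3 := hpair u v
      have h4 := hc0 u v
      nlinarith [mul_nonneg (sub_nonneg.2 h2) (sub_nonneg.2 h3), mul_nonneg h4 (sub_nonneg.2 h2)]
  have hsum := sum_le_sum fun u hu => sum_le_sum fun v hv => hpt u hu v hv
  have hswap : ∑ u ∈ W, ∑ v ∈ W, A u v * c u v * d v = ∑ u ∈ W, ∑ v ∈ W, A u v * c u v * d u := by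
    rw [sum_comm]
    refine sum_congr rfl fun v _ => sum_congr rfl fun u _ => ?_
    rw [hsymm u v, hcs u v]
  have hswap' : ∑ u ∈ W, ∑ v ∈ W, A u v * d v = ∑ u ∈ W, d u ^ 2 := by
    rw [sum_comm]
    refine sum_congr rfl fun v _ => ?_
    rw [← sum_mul, sq]
    congr 1
    rw [hd]
    exact sum_congr rfl fun u _ => hsymm _ _
  have hself : ∑ u ∈ W, ∑ v ∈ W, A u v * d u = ∑ u ∈ W, d u ^ 2 := by
    refine sum_congr rfl fun v _ => ?_
    rw [← sum_mul, ← hd, sq]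
  have e1 : ∑ u ∈ W, ∑ v ∈ W, A u v * (n * (d u + d v - n)) =
      n * (2 * ∑ u ∈ W, d u ^ 2 - n * ∑ u ∈ W, d u) := by
    have : ∀ u v, A u v * (n * (d u + d v - n)) =
      n * (A u v * d u) + n * (A u v * d v) - n * n * A u v := fun u v => by ring
    simp only [this, sum_add_distrib, sum_sub_distrib, ← mul_sum]
    rw [hself, hswap']
    simp only [← hd]
    ring
  have e2 : ∑ u ∈ W, ∑ v ∈ W,
      A u v * (6 * (c u v * (d u + d v)) - 12 * (c u v * c u v) - 4 * (n * c u v)) =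
      12 * ∑ u ∈ W, ∑ v ∈ W, A u v * c u v * d u -
      12 * ∑ u ∈ W, ∑ v ∈ W, A u v * c u v * c u v -
      4 * (n * ∑ u ∈ W, ∑ v ∈ W, A u v * c u v) := by
    have : ∀ u v,
      A u v * (6 * (c u v * (d u + d v)) - 12 * (c u v * c u v) - 4 * (n * c u v)) =
      6 * (A u v * c u v * d u) + 6 * (A u v * c u v * d v) - 12 * (A u v * c u v * c u v) -
        4 * n * (A u v * c u v) := fun u v => by ring
    simp only [this, sum_add_distrib, sum_sub_distrib, ← mul_sum]
    rw [hswap]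
    ring
  rw [e1, e2] at hsum
  -- Cauchy–Schwarz turns `2 * ∑ d² ≤ n * ∑ d` into `2 * ∑ d ≤ n ^ 2`, against the density
  -- assumption.
  have hcs2 := sq_sum_le_card_mul_sum_sq (s := W) (f := d)
  have h5 : n * (2 * ∑ u ∈ W, d u ^ 2 - n * ∑ u ∈ W, d u) ≤ 0 := by linarith
  have hn0 : 0 ≤ n := by positivity
  have hD : 0 < ∑ u ∈ W, d u := by nlinarith
  rw [← hn] at hcs2
  nlinarith

/-- A graph on `4r - 1` vertices of average degree at least `2r` contains a book with `t` pages
as soon as `3 t ≤ 2 r + 2`. -/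
theorem exists_book_of_degSum {V : Type*} {G : SimpleGraph V} {r t : ℕ} (hr : 1 ≤ r)
    (hrt : 3 * t ≤ 2 * r + 2) (W : Finset V) (hcard : W.card = 2 * (2 * r) - 1)
    (hsum : 2 * r * (2 * (2 * r) - 1) ≤ degSum G W) :
    ∃ u ∈ W, ∃ v ∈ W, G.Adj u v ∧ ∃ P ⊆ W, P.card = t ∧ ∀ x ∈ P, G.Adj u x ∧ G.Adj v x := by
  classical
  have hdeg : (degSum G W : ℤ) = ∑ u ∈ W, ∑ v ∈ W, if G.Adj u v then (1 : ℤ) else 0 := by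
    unfold degSum degIn
    push_cast [Finset.card_filter]
    rfl
  obtain ⟨u, hu, v, hv, huv, hlarge⟩ := exists_large_codegree W
    (fun u v => if G.Adj u v then (1 : ℤ) else 0)
    (fun u v => by split_ifs <;> simp)
    (fun u v => by simp only [G.adj_comm])
    (by
      rw [← hdeg]
      rw [hcard]
      zify [show 1 ≤ 2 * (2 * r) by omega] at hsum ⊢
      have : (1 : ℤ) ≤ r := by exact_mod_cast hr
      nlinarith)
  have hadj : G.Adj u v := by
    by_contra h
    simp [h] at huv
  have hcod : ∑ x ∈ W, (if G.Adj u x then (1 : ℤ) else 0) * (if G.Adj v x then 1 else 0) =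
      ((W.filter fun x => G.Adj u x ∧ G.Adj v x).card : ℤ) := by
    rw [Finset.card_filter]
    push_cast
    refine Finset.sum_congr rfl fun x _ => ?_
    by_cases h1 : G.Adj u x <;> by_cases h2 : G.Adj v x <;> simp [h1, h2]
  rw [hcod, hcard] at hlarge
  -- A codegree exceeding `(4r - 1) / 6` is an integer at least `2r / 3`, hence at least `t` because
  -- `3t ≤ 2r + 2`.
  obtain ⟨P, hP, hPc⟩ := Finset.exists_subset_card_eq
    (show t ≤ (W.filter fun x => G.Adj u x ∧ G.Adj v x).card by omega)
  exact ⟨u, hu, v, hv, hadj, P, hP.trans (Finset.filter_subset _ _), hPc,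
    fun x hx => (Finset.mem_filter.1 (hP hx)).2⟩

end Books

/-! ### Greedy construction of a clique with a large common neighbourhood. -/

section Greedy

variable {V : Type*} {G : SimpleGraph V}

/-- If in every vertex set the average degree of the complement of `G` is at most `m - 2`, then
every large vertex set contains a clique of size `s` joined completely to a set of size `q`. -/
theorem exists_clique_joined {m : ℕ} (hm : 2 ≤ m)
    (hG : ∀ W : Finset V, W.card * (W.card + 1) ≤ degSum G W + m * W.card) (q : ℕ) (s : ℕ)
    (hq : 0 < q) (W : Finset V) (hW : s * (m - 1) + q ≤ W.card) :
    ∃ (w : Fin s → V) (W' : Finset V), W' ⊆ W ∧ W'.card = q ∧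
      (∀ i j, i ≠ j → G.Adj (w i) (w j)) ∧ ∀ i, ∀ x ∈ W', G.Adj (w i) x := by
  classical
  suffices h : ∃ (w : Fin s → V) (W' : Finset V), W' ⊆ W ∧ W'.card = q ∧ (∀ i, w i ∈ W) ∧
      (∀ i j, i ≠ j → G.Adj (w i) (w j)) ∧ ∀ i, ∀ x ∈ W', G.Adj (w i) x by
    obtain ⟨w, W', h1, h2, -, h3, h4⟩ := h
    exact ⟨w, W', h1, h2, h3, h4⟩
  induction s generalizing W with
  | zero =>
    obtain ⟨W', h1, h2⟩ := Finset.exists_subset_card_eq (show q ≤ W.card by omega)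
    exact ⟨Fin.elim0, W', h1, h2, fun i => i.elim0, fun i => i.elim0, fun i => i.elim0⟩
  | succ s ih =>
    have hWpos : 0 < W.card := by omega
    -- A vertex of at least average degree: passing to its neighbourhood loses at most `m - 1`
    -- vertices, itself included.
    obtain ⟨v, hv, hdeg⟩ : ∃ v ∈ W, W.card + 1 ≤ degIn G W v + m := by
      by_contra hcon
      push Not at hcon
      have h1 : ∑ v ∈ W, (degIn G W v + m) < ∑ v ∈ W, (W.card + 1) :=
        Finset.sum_lt_sum_of_nonempty (Finset.card_pos.1 hWpos) hcon
      rw [Finset.sum_add_distrib, Finset.sum_const, Finset.sum_const, smul_eq_mul,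
        smul_eq_mul] at h1
      have h2 := hG W
      unfold degSum at h2
      rw [mul_comm m] at h2
      omega
    obtain ⟨w, W', h1, h2, h3, h4, h5⟩ := ih (W.filter (G.Adj v)) (by
      unfold degIn at hdeg
      rw [Nat.succ_mul] at hW
      omega)
    refine ⟨Fin.cons v w, W', h1.trans (Finset.filter_subset _ _), h2, ?_, ?_, ?_⟩
    · intro i
      refine Fin.cases ?_ (fun i => ?_) i
      · simpa using hv
      · simpa using (Finset.mem_filter.1 (h3 i)).1
    · intro i j
      refine Fin.cases ?_ (fun i => ?_) i <;> refine Fin.cases ?_ (fun j => ?_) j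
      · intro h; exact absurd rfl h
      · intro _; simpa using (Finset.mem_filter.1 (h3 j)).2
      · intro _; simpa using (Finset.mem_filter.1 (h3 i)).2.symm
      · intro h; simpa using h4 i j (fun e => h (by rw [e]))
    · intro i x hx
      refine Fin.cases ?_ (fun i => ?_) i
      · simpa using (Finset.mem_filter.1 (h1 hx)).2
      · simpa using h5 i x hx

end Greedy

/-! ### The graph of fixed edges and the density forced by the absence of free stars. -/

section FixedGraph

variable {n : ℕ}

/-- The edge of `K_n` with the given ends. -/
def edgeOf {x y : Fin n} (h : x ≠ y) : CompleteEdges n := ⟨s(x, y), by simpa using h⟩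

theorem exists_eq_edgeOf (e : CompleteEdges n) : ∃ (x y : Fin n) (h : x ≠ y), e = edgeOf h := by
  obtain ⟨e, he⟩ := e
  induction e using Sym2.ind with
  | _ x y => exact ⟨x, y, by simpa using he, rfl⟩

/-- The graph formed by the edges fixed by `f`. -/
def fixedGraph (f : CompleteEdges n → CompleteEdges n) : SimpleGraph (Fin n) where
  Adj x y := ∃ h : x ≠ y, f (edgeOf h) = edgeOf h
  symm := ⟨fun x y ⟨h, hf⟩ => ⟨h.symm, by
    have : edgeOf h.symm = edgeOf h := Subtype.ext Sym2.eq_swap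
    rw [this, hf]⟩⟩
  loopless := ⟨fun _ h => h.1 rfl⟩

theorem exists_fixed_copy {V : Type*} {G : SimpleGraph V}
    (f : CompleteEdges n → CompleteEdges n) (φ : V → Fin n) (hφ : Function.Injective φ)
    (hadj : ∀ a b, G.Adj a b → (fixedGraph f).Adj (φ a) (φ b)) :
    ∃ S : (⊤ : SimpleGraph (Fin n)).Subgraph, Nonempty (G ≃g S.coe) ∧ IsFixedBy f S := by
  let c : SimpleGraph.Copy G (⊤ : SimpleGraph (Fin n)) :=
    ⟨⟨φ, fun {a b} h => by simpa using (hadj a b h).1⟩, hφ⟩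
  refine ⟨c.toSubgraph, ⟨c.isoToSubgraph⟩, fun e he => ?_⟩
  obtain ⟨x, y, hxy, rfl⟩ := exists_eq_edgeOf e
  have he' : c.toSubgraph.Adj x y := he
  rw [SimpleGraph.Subgraph.map_adj] at he'
  obtain ⟨a, b, hab, rfl, rfl⟩ := he'
  exact (hadj a b hab).2

theorem exists_free_star {r : ℕ} (f : CompleteEdges n → CompleteEdges n) (v : Fin n)
    (D : Finset (Fin n)) (hD : D.card = r) (hv : v ∉ D)
    (hfree : ∀ x ∈ D, ∀ (h : v ≠ x), ∀ y ∈ D, (f (edgeOf h) : Sym2 (Fin n)) ≠ s(v, y)) :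
    ∃ S : (⊤ : SimpleGraph (Fin n)).Subgraph, Nonempty (starK r ≃g S.coe) ∧ IsFreeFor f S := by
  let ψ : Fin r → Fin n := fun i => (D.equivFinOfCardEq hD).symm i
  have hψ : ∀ i, ψ i ∈ D := fun i => ((D.equivFinOfCardEq hD).symm i).2
  have hψv : ∀ i, v ≠ ψ i := fun i e => hv (e ▸ hψ i)
  have hψinj : Function.Injective ψ := fun i j e =>
    (D.equivFinOfCardEq hD).symm.injective (Subtype.ext e)
  let φ : Fin 1 ⊕ Fin r → Fin n := Sum.elim (fun _ => v) ψ
  have hφ : Function.Injective φ := by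
    rintro (i | i) (j | j) e
    · rw [Subsingleton.elim i j]
    · exact absurd e (hψv j)
    · exact absurd e.symm (hψv i)
    · rw [hψinj e]
  let c : SimpleGraph.Copy (starK r) (⊤ : SimpleGraph (Fin n)) :=
    ⟨⟨φ, fun {a b} h => by
      rw [SimpleGraph.top_adj]
      exact fun e => h.ne (hφ e)⟩, hφ⟩
  have hedge : ∀ e : CompleteEdges n, (e : Sym2 (Fin n)) ∈ c.toSubgraph.edgeSet →
      ∃ i, (e : Sym2 (Fin n)) = s(v, ψ i) := by
    intro e he
    obtain ⟨x, y, hxy, rfl⟩ := exists_eq_edgeOf e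
    have he' : c.toSubgraph.Adj x y := he
    rw [SimpleGraph.Subgraph.map_adj] at he'
    obtain ⟨a, b, hab, rfl, rfl⟩ := he'
    rcases a with a | a <;> rcases b with b | b
    · simp at hab
    · exact ⟨b, rfl⟩
    · exact ⟨a, Sym2.eq_swap⟩
    · simp at hab
  refine ⟨c.toSubgraph, ⟨c.isoToSubgraph⟩, fun e he he' => ?_⟩
  obtain ⟨i, hi⟩ := hedge e he
  obtain ⟨j, hj⟩ := hedge _ he'
  have : e = edgeOf (hψv i) := Subtype.ext hi
  rw [this] at hj
  exact hfree (ψ i) (hψ i) (hψv i) (ψ j) (hψ j) hj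

open Classical in
/-- Without an `f`-free star with `r` edges the graph of non-fixed edges has average degree at
most `2r - 2` on every vertex set. -/
theorem degSum_fixedGraph {r : ℕ} (hr : 1 ≤ r) (f : CompleteEdges n → CompleteEdges n)
    (hno : ¬ ∃ S : (⊤ : SimpleGraph (Fin n)).Subgraph,
      Nonempty (starK r ≃g S.coe) ∧ IsFreeFor f S) (W : Finset (Fin n)) :
    W.card * (W.card + 1) ≤ degSum (fixedGraph f) W + 2 * r * W.card := by
  let B : Fin n → Finset (Fin n) :=
    fun v => W.filter (fun x => v ≠ x ∧ ¬ (fixedGraph f).Adj v x)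
  -- `Q v x` charges the non-fixed edge `vx` to `v`: its image is not an edge from `v` to `B v`. Any
  -- set of edges charged to `v` is therefore a free star.
  let Q : Fin n → Fin n → Prop := fun v x =>
    ∃ h : v ≠ x, ∀ y ∈ B v, (f (edgeOf h) : Sym2 (Fin n)) ≠ s(v, y)
  have hQcard : ∀ v, ((B v).filter (Q v)).card ≤ r - 1 := by
    intro v
    by_contra hcon
    obtain ⟨D, hD, hDc⟩ := Finset.exists_subset_card_eq
      (show r ≤ ((B v).filter (Q v)).card by omega)
    refine hno (exists_free_star f v D hDc (fun hv => ?_) (fun x hx h y hy => ?_))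
    · exact (Finset.mem_filter.1 (Finset.mem_filter.1 (hD hv)).1).2.1 rfl
    · exact (Finset.mem_filter.1 (hD hx)).2.2 y (Finset.mem_filter.1 (hD hy)).1
  -- An image containing both `v` and `x` would be the edge `vx` itself, which would then be fixed.
  have hcover : ∀ v ∈ W, ∀ x ∈ B v, Q v x ∨ Q x v := by
    intro v hv x hx
    have hx' := Finset.mem_filter.1 hx
    have hvx : v ≠ x := hx'.2.1
    by_contra hcon
    have h1 : ∃ y ∈ B v, (f (edgeOf hvx) : Sym2 (Fin n)) = s(v, y) := by
      by_contra h; push Not at h; exact hcon (Or.inl ⟨hvx, h⟩)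
    have hsw : edgeOf hvx.symm = edgeOf hvx := Subtype.ext Sym2.eq_swap
    have h2 : ∃ y ∈ B x, (f (edgeOf hvx) : Sym2 (Fin n)) = s(x, y) := by
      by_contra h; push Not at h; exact hcon (Or.inr ⟨hvx.symm, by rwa [hsw]⟩)
    obtain ⟨y, -, hy⟩ := h1
    obtain ⟨z, -, hz⟩ := h2
    apply hx'.2.2
    refine ⟨hvx, Subtype.ext ?_⟩
    have hxm : x ∈ (f (edgeOf hvx) : Sym2 (Fin n)) := by rw [hz]; exact Sym2.mem_mk_left x z
    rw [hy] at hxm ⊢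
    rcases Sym2.mem_iff.1 hxm with e | e
    · exact absurd e.symm hvx
    · rw [← e]; rfl
  have hBsymm : ∀ v ∈ W, ∀ x, x ∈ B v → v ∈ B x := by
    intro v hv x hx
    have hx' := Finset.mem_filter.1 hx
    exact Finset.mem_filter.2 ⟨hv, hx'.2.1.symm, fun h => hx'.2.2 h.symm⟩
  have hBsum : ∑ v ∈ W, (B v).card ≤ W.card * (2 * (r - 1)) := by
    have h1 : ∀ v ∈ W, (B v).card ≤ ((B v).filter (Q v)).card +
        ((B v).filter (fun x => Q x v)).card := by
      intro v hv
      refine le_trans (Finset.card_le_card fun x hx => ?_) (Finset.card_union_le _ _)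
      rcases hcover v hv x hx with h | h
      · exact Finset.mem_union_left _ (Finset.mem_filter.2 ⟨hx, h⟩)
      · exact Finset.mem_union_right _ (Finset.mem_filter.2 ⟨hx, h⟩)
    have h2 : ∑ v ∈ W, ((B v).filter (fun x => Q x v)).card =
        ∑ v ∈ W, ((B v).filter (Q v)).card := by
      have e1 : ∀ v ∈ W, ((B v).filter (fun x => Q x v)).card =
          ∑ x ∈ W, if x ∈ B v ∧ Q x v then 1 else 0 := by
        intro v _
        rw [← Finset.card_filter]
        congr 1
        ext x
        simp only [Finset.mem_filter, B]
        tauto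
      have e2 : ∀ v ∈ W, ((B v).filter (Q v)).card =
          ∑ x ∈ W, if x ∈ B v ∧ Q v x then 1 else 0 := by
        intro v _
        rw [← Finset.card_filter]
        congr 1
        ext x
        simp only [Finset.mem_filter, B]
        tauto
      rw [Finset.sum_congr rfl e1, Finset.sum_congr rfl e2, Finset.sum_comm]
      refine Finset.sum_congr rfl fun v hv => Finset.sum_congr rfl fun x hx => ?_
      have : v ∈ B x ↔ x ∈ B v := ⟨hBsymm x hx v, hBsymm v hv x⟩
      simp only [this]
    have h3 := Finset.sum_le_sum h1
    rw [Finset.sum_add_distrib, h2] at h3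
    have h4 : ∑ v ∈ W, ((B v).filter (Q v)).card ≤ ∑ v ∈ W, (r - 1) :=
      Finset.sum_le_sum fun v _ => hQcard v
    rw [Finset.sum_const, smul_eq_mul] at h4
    calc _ ≤ _ := h3
      _ ≤ W.card * (r - 1) + W.card * (r - 1) := Nat.add_le_add h4 h4
      _ = _ := by ring
  have hpart : ∀ v ∈ W, W.card ≤ degIn (fixedGraph f) W v + (B v).card + 1 := by
    intro v hv
    have : W ⊆ insert v (W.filter ((fixedGraph f).Adj v) ∪ B v) := by
      intro x hx
      rw [Finset.mem_insert, Finset.mem_union, Finset.mem_filter]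
      by_cases h1 : x = v
      · exact Or.inl h1
      · by_cases h2 : (fixedGraph f).Adj v x
        · exact Or.inr (Or.inl ⟨hx, h2⟩)
        · exact Or.inr (Or.inr (Finset.mem_filter.2 ⟨hx, fun e => h1 e.symm, h2⟩))
    refine (Finset.card_le_card this).trans ((Finset.card_insert_le _ _).trans ?_)
    exact Nat.add_le_add_right (Finset.card_union_le _ _) 1
  have hsum := Finset.sum_le_sum hpart
  rw [Finset.sum_add_distrib, Finset.sum_add_distrib, Finset.sum_const, Finset.sum_const,
    smul_eq_mul, smul_eq_mul] at hsum
  change _ ≤ degSum (fixedGraph f) W + _ + _ at hsum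
  obtain ⟨r, rfl⟩ : ∃ r', r = r' + 1 := ⟨r - 1, by omega⟩
  simp only [Nat.add_sub_cancel] at hBsum
  nlinarith

end FixedGraph

/-! ### Upper bounds: the fixed copies. -/

section UpperBounds

/-- Every `f` on enough vertices has an `f`-free star or a fixed clique joined in the fixed graph
to a dense vertex set. -/
theorem exists_dense_of_no_free_star {n r : ℕ} (hr : 1 ≤ r) (s : ℕ)
    (hn : (s + 2) * (2 * r - 1) + 1 ≤ n) (f : CompleteEdges n → CompleteEdges n)
    (hno : ¬ ∃ S : (⊤ : SimpleGraph (Fin n)).Subgraph,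
      Nonempty (starK r ≃g S.coe) ∧ IsFreeFor f S) :
    ∃ (w : Fin s → Fin n) (W : Finset (Fin n)), W.card = 2 * (2 * r) - 1 ∧
      2 * r * (2 * (2 * r) - 1) ≤ degSum (fixedGraph f) W ∧
      (∀ i j, i ≠ j → (fixedGraph f).Adj (w i) (w j)) ∧
      ∀ i, ∀ x ∈ W, (fixedGraph f).Adj (w i) x := by
  have hG := degSum_fixedGraph hr f hno
  -- The sizes match exactly, since `(s + 2) * (2r - 1) + 1 = s * (2r - 1) + (4r - 1)`.
  obtain ⟨w, W, -, h2, h3, h4⟩ := exists_clique_joined (m := 2 * r) (by omega) hG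
    (2 * (2 * r) - 1) s (by omega) Finset.univ (by
      rw [Finset.card_univ, Fintype.card_fin]
      rw [add_mul] at hn
      omega)
  refine ⟨w, W, h2, ?_, h3, h4⟩
  have := hG W
  rw [h2, show 2 * (2 * r) - 1 + 1 = 2 * r + 2 * r by omega, mul_add, mul_comm _ (2 * r)] at this
  omega

theorem completeMinusClique_mem_mixedRamseySet {k t r : ℕ} (hk : t + 2 ≤ k) (ht : 1 ≤ t)
    (hrt : 3 * t ≤ 2 * r + 2) :
    (k - t) * (2 * r - 1) + 1 ∈ mixedRamseySet (completeMinusClique k t) (starK r) := by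
  intro f
  by_contra hcon
  rw [not_or] at hcon
  have hr : 1 ≤ r := by omega
  obtain ⟨w, W, hW, hsum, hw, hwW⟩ := exists_dense_of_no_free_star hr (k - t - 2)
    (by rw [show k - t - 2 + 2 = k - t by omega]) f hcon.2
  obtain ⟨u, hu, v, hv, huv, P, hPW, hPc, hP⟩ := exists_book_of_degSum hr hrt W hW hsum
  set F := fixedGraph f with hF
  let p : Fin t → Fin ((k - t) * (2 * r - 1) + 1) := fun i => (P.equivFinOfCardEq hPc).symm i
  have hp : ∀ i, p i ∈ P := fun i => ((P.equivFinOfCardEq hPc).symm i).2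
  have hpinj : ∀ i j, p i = p j → i = j := fun i j e =>
    (P.equivFinOfCardEq hPc).symm.injective (Subtype.ext e)
  -- The independent vertices go to the pages, the next two to the spine `u`, `v`, the remaining `k
  -- - t - 2` to the clique. The final `u` is a default value never reached.
  let φ : Fin k → Fin ((k - t) * (2 * r - 1) + 1) := fun i =>
    if h : i.1 < t then p ⟨i.1, h⟩
    else if i.1 = t then u else if i.1 = t + 1 then v
    else if h : i.1 - (t + 2) < k - t - 2 then w ⟨i.1 - (t + 2), h⟩ else u
  have hlt : ∀ a b : Fin k, a.1 < b.1 → ¬ b.1 < t → F.Adj (φ b) (φ a) := by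
    intro a b hab hb
    have hbk := b.2
    simp only [φ]
    by_cases b1 : b.1 = t
    · simp only [b1, lt_irrefl, dite_false, if_true, show a.1 < t by omega, dite_true]
      exact (hP _ (hp _)).1
    by_cases b2 : b.1 = t + 1
    · simp only [b2, show ¬ t + 1 < t by omega, show t + 1 ≠ t by omega, dite_false, if_true,
        if_false]
      by_cases a1 : a.1 < t
      · simp only [a1, dite_true]
        exact (hP _ (hp _)).2
      · simp only [show a.1 = t by omega, lt_irrefl, dite_false, if_true]
        exact huv.symm
    · simp only [hb, b1, b2, show b.1 - (t + 2) < k - t - 2 by omega, dite_false, dite_true,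
        if_false]
      by_cases a1 : a.1 < t
      · simp only [a1, dite_true]
        exact hwW _ _ (hPW (hp _))
      by_cases a2 : a.1 = t
      · simp only [a2, lt_irrefl, dite_false, if_true]
        exact hwW _ _ hu
      by_cases a3 : a.1 = t + 1
      · simp only [a3, show ¬ t + 1 < t by omega, show t + 1 ≠ t by omega, dite_false, if_true,
          if_false]
        exact hwW _ _ hv
      · simp only [a1, a2, a3, show a.1 - (t + 2) < k - t - 2 by omega, dite_false, dite_true,
          if_false]
        exact hw _ _ (fun e => by
          have := congrArg Fin.val e
          simp only at this
          omega)
  have hadj : ∀ a b, (completeMinusClique k t).Adj a b → F.Adj (φ a) (φ b) := by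
    rintro a b ⟨hab, hnot⟩
    rcases lt_or_gt_of_ne (fun e => hab (Fin.ext e)) with h | h
    · exact (hlt a b h (by omega)).symm
    · exact hlt b a h (by omega)
  refine hcon.1 (exists_fixed_copy f φ (fun a b e => ?_) hadj)
  by_contra hab
  by_cases h : a.1 < t ∧ b.1 < t
  · simp only [φ, h.1, h.2, dite_true] at e
    have := congrArg Fin.val (hpinj _ _ e)
    exact hab (Fin.ext this)
  · exact (hadj a b ⟨hab, h⟩).ne e

theorem cycleGraph_join_mem_mixedRamseySet {k t r : ℕ} (hk : 3 ≤ k) (hkr : k - 1 ≤ r) :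
    (t + 2) * (2 * r - 1) + 1 ∈ mixedRamseySet
      (graphJoin (SimpleGraph.cycleGraph (2 * k - 1)) (⊤ : SimpleGraph (Fin t))) (starK r) := by
  intro f
  by_contra hcon
  rw [not_or] at hcon
  obtain ⟨w, W, hW, hsum, hw, hwW⟩ :=
    exists_dense_of_no_free_star (r := r) (by omega) t le_rfl f hcon.2
  -- The condition `k - 1 ≤ r` says exactly that `2k - 1` is at most `m + 1` for `m = 2r`.
  obtain ⟨c, hc⟩ := exists_cycle_of_degSum (m := 2 * r) (l := 2 * k - 1) (by omega) (by omega)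
    (by omega) W hW hsum
  set F := fixedGraph f with hF
  have hcyc : ∀ a b : Fin (2 * k - 1), (a - b).1 = 1 → F.Adj (c a.1) (c b.1) := by
    intro a b hab
    have ha := a.2
    have hb := b.2
    rw [Fin.sub_def] at hab
    simp only at hab
    by_cases h : b.1 ≤ a.1
    · rw [show 2 * k - 1 - b.1 + a.1 = (a.1 - b.1) + (2 * k - 1) by omega, Nat.add_mod_right,
        Nat.mod_eq_of_lt (by omega)] at hab
      rw [show a.1 = b.1 + 1 by omega]
      exact (hc.adj _ (by omega)).symm
    · rw [Nat.mod_eq_of_lt (by omega)] at hab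
      rw [show a.1 = 0 by omega, show b.1 = 2 * k - 1 - 1 by omega]
      exact hc.close.symm
  let φ : Fin (2 * k - 1) ⊕ Fin t → Fin ((t + 2) * (2 * r - 1) + 1) := Sum.elim (fun i => c i.1) w
  refine hcon.1 (exists_fixed_copy f φ ?_ ?_)
  · rintro (a | a) (b | b) e
    · rw [Fin.ext (hc.inj _ _ a.2 b.2 e)]
    · exact absurd e.symm (hwW b _ (hc.mem _ a.2)).ne
    · exact absurd e (hwW a _ (hc.mem _ b.2)).ne
    · by_cases h : a = b
      · rw [h]
      · exact absurd e (hw a b h).ne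
  · rintro (a | a) (b | b) h
    · have h' : (SimpleGraph.cycleGraph (2 * k - 1)).Adj a b := by
        simpa [graphJoin] using h
      rw [SimpleGraph.cycleGraph_adj'] at h'
      rcases h' with h' | h'
      · exact hcyc a b h'
      · exact (hcyc b a h').symm
    · exact (hwW b _ (hc.mem _ a.2)).symm
    · exact hwW a _ (hc.mem _ b.2)
    · have h' : a ≠ b := by simpa [graphJoin] using h
      exact hw a b h'

end UpperBounds

/-! ### Lower bounds: the block construction. -/

section LowerBounds

/-- The block of length `2r - 1` containing `x`. -/
def block {n : ℕ} (r : ℕ) (x : Fin n) : ℕ := x.1 / (2 * r - 1)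

/-- The cyclic difference of the positions of `y` and `x` in their blocks. -/
def cyclicDiff {n : ℕ} (r : ℕ) (x y : Fin n) : ZMod (2 * r - 1) :=
  (y.1 : ZMod (2 * r - 1)) - (x.1 : ZMod (2 * r - 1))

variable {n r : ℕ}

theorem eq_of_block_eq_of_cyclicDiff_eq {x y z : Fin n} (h : block r y = block r z)
    (h' : cyclicDiff r x y = cyclicDiff r x z) : y = z := by
  unfold cyclicDiff at h'
  have h1 := sub_left_injective h'
  rw [ZMod.natCast_eq_natCast_iff'] at h1
  apply Fin.ext
  rw [← Nat.div_add_mod y.1 (2 * r - 1), ← Nat.div_add_mod z.1 (2 * r - 1), h1]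
  unfold block at h
  rw [h]

theorem cyclicDiff_ne_zero {x y : Fin n} (h : block r x = block r y) (hxy : x ≠ y) :
    cyclicDiff r x y ≠ 0 := fun h0 =>
  hxy (eq_of_block_eq_of_cyclicDiff_eq (x := x) h (by rw [h0]; simp [cyclicDiff]))

theorem cyclicDiff_swap (x y : Fin n) : cyclicDiff r y x = -cyclicDiff r x y := by
  simp [cyclicDiff]

theorem val_add_val_neg (hr : 1 ≤ r) {a : ZMod (2 * r - 1)} (ha : a ≠ 0) :
    a.val + (-a).val = 2 * r - 1 := by
  have : NeZero (2 * r - 1) := ⟨by omega⟩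
  rw [ZMod.neg_val, if_neg ha]
  have := a.val_lt
  omega

/-- Requirements on the image `e'` of an edge `e`: edges between blocks are fixed, edges inside
blocks are not, and an edge at `x` is mapped to the opposite edge at its tail `x`. -/
structure IsBlockImage (r : ℕ) (e e' : CompleteEdges n) : Prop where
  fixed : ∀ x y (h : x ≠ y), e = edgeOf h → block r x ≠ block r y → e' = e
  moved : ∀ x y (h : x ≠ y), e = edgeOf h → block r x = block r y → e' ≠ e
  opposite : ∀ x y (h : x ≠ y) z (hz : x ≠ z), e = edgeOf h → block r x = block r y →
    block r z = block r x → (cyclicDiff r x y).val < r →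
    cyclicDiff r x z = -cyclicDiff r x y → e' = edgeOf hz

theorem edgeOf_eq_iff {x y x' y' : Fin n} (h : x ≠ y) (h' : x' ≠ y') :
    edgeOf h = edgeOf h' ↔ x = x' ∧ y = y' ∨ x = y' ∧ y = x' := by
  unfold edgeOf
  rw [Subtype.mk.injEq, Sym2.eq_iff]

/-- The requirements are consistent because `2r - 1` is odd: exactly one end of an edge inside a
block is its tail, and an edge is never its own opposite. When the block is incomplete and the
opposite edge is missing, any other edge serves, which is where a third vertex is needed. -/
theorem exists_isBlockImage (hn : 3 ≤ n) (hr : 1 ≤ r) (e : CompleteEdges n) :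
    ∃ e', IsBlockImage r e e' := by
  obtain ⟨x, y, hxy, rfl⟩ := exists_eq_edgeOf e
  have hblock : ∀ x' y' (h : x' ≠ y'), edgeOf hxy = edgeOf h →
      (block r x' = block r y' ↔ block r x = block r y) := by
    intro x' y' h he
    rcases (edgeOf_eq_iff _ _).1 he with ⟨rfl, rfl⟩ | ⟨rfl, rfl⟩
    · exact Iff.rfl
    · exact eq_comm
  by_cases hb : block r x = block r y
  · by_cases hex : ∃ x' y', ∃ (h : x' ≠ y'), ∃ z, ∃ (_ : x' ≠ z), edgeOf hxy = edgeOf h ∧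
        block r z = block r x' ∧ (cyclicDiff r x' y').val < r ∧
        cyclicDiff r x' z = -cyclicDiff r x' y'
    · obtain ⟨x', y', h, z, hz, he, hzb, hlt, hopp⟩ := hex
      rw [he] at hblock ⊢
      have hb' := (hblock x' y' h rfl).2 hb
      have hsum := val_add_val_neg hr (cyclicDiff_ne_zero hb' h)
      refine ⟨edgeOf hz, ⟨?_, ?_, ?_⟩⟩
      · intro a b hab he' hbl
        exact absurd ((hblock a b hab he').2 hb) hbl
      · intro _ _ _ _ _ heq
        rcases (edgeOf_eq_iff _ _).1 heq with ⟨-, rfl⟩ | ⟨rfl, -⟩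
        · rw [← hopp] at hsum
          omega
        · exact h rfl
      · intro a b hab c hc he' _ hcb hlt' hopp'
        rcases (edgeOf_eq_iff _ _).1 he' with ⟨rfl, rfl⟩ | ⟨rfl, rfl⟩
        · rw [edgeOf_eq_iff]
          exact Or.inl ⟨rfl, eq_of_block_eq_of_cyclicDiff_eq (hzb.trans hcb.symm)
            (hopp.trans hopp'.symm)⟩
        · rw [cyclicDiff_swap] at hlt'
          omega
    · obtain ⟨w, hw⟩ : ∃ w : Fin n, w ∉ ({x, y} : Finset (Fin n)) := by
        by_contra hcon
        push Not at hcon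
        have h1 : (Finset.univ : Finset (Fin n)) ⊆ {x, y} := fun w _ => hcon w
        have h2 := (Finset.card_le_card h1).trans Finset.card_le_two
        rw [Finset.card_univ, Fintype.card_fin] at h2
        omega
      rw [Finset.mem_insert, Finset.mem_singleton, not_or] at hw
      refine ⟨edgeOf (Ne.symm hw.1), ⟨?_, ?_, ?_⟩⟩
      · intro a b hab he' hbl
        exact absurd ((hblock a b hab he').2 hb) hbl
      · intro _ _ _ _ _ heq
        rcases (edgeOf_eq_iff _ _).1 heq with ⟨-, h⟩ | ⟨h, -⟩
        · exact hw.2 h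
        · exact hxy h
      · intro a b hab c hc he' _ hcb hlt' hopp'
        exact absurd ⟨a, b, hab, c, hc, he', hcb, hlt', hopp'⟩ hex
  · refine ⟨edgeOf hxy, ⟨fun _ _ _ _ _ => rfl, ?_, ?_⟩⟩
    · intro a b hab he' hbl
      exact absurd ((hblock a b hab he').1 hbl) hb
    · intro a b hab _ _ he' hbl
      exact absurd ((hblock a b hab he').1 hbl) hb

/-- Pigeonhole: `min (a i).val (-a i).val` takes values between `1` and `r - 1`, and two distinct
residues sharing it are opposite. -/
theorem exists_opposite (hr : 1 ≤ r) (a : Fin r → ZMod (2 * r - 1)) (ha : ∀ i, a i ≠ 0)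
    (hinj : Function.Injective a) : ∃ i j, a j = -a i ∧ (a i).val < r := by
  have : NeZero (2 * r - 1) := ⟨by omega⟩
  have hsum := fun i => val_add_val_neg hr (ha i)
  have hpos : ∀ i, 0 < (a i).val := fun i =>
    Nat.pos_of_ne_zero fun h => ha i ((ZMod.val_eq_zero _).1 h)
  have hpos' : ∀ i, 0 < (-a i).val := fun i =>
    Nat.pos_of_ne_zero fun h => ha i (neg_eq_zero.1 ((ZMod.val_eq_zero _).1 h))
  obtain ⟨i, j, hij, he⟩ := Fintype.exists_ne_map_eq_of_card_lt
    (fun i : Fin r => (⟨min (a i).val (-a i).val - 1, by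
      have := hsum i; have := hpos i; have := hpos' i; omega⟩ : Fin (r - 1)))
    (by rw [Fintype.card_fin, Fintype.card_fin]; omega)
  rw [Fin.mk.injEq] at he
  have h1 := hsum i; have h2 := hpos i; have h3 := hpos' i
  have h4 := hsum j; have h5 := hpos j; have h6 := hpos' j
  have hne : (a i).val ≠ (a j).val := fun h => hij (hinj (ZMod.val_injective _ h))
  have hopp : a j = -a i := ZMod.val_injective _ (by omega)
  by_cases hlt : (a i).val < r
  · exact ⟨i, j, hopp, hlt⟩
  · exact ⟨j, i, by rw [hopp, neg_neg], by omega⟩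

/-- Block numbers properly colour the fixed graph with `s` colours. A free star has no fixed edge,
so it lies in one block, where `exists_opposite` finds an edge mapped into the star. -/
theorem not_mem_mixedRamseySet {V : Type*} [Fintype V] {G : SimpleGraph V} {s : ℕ}
    (hr : 1 ≤ r) (hV : 3 ≤ Fintype.card V) (hG : ¬ G.Colorable s)
    (hn : n ≤ s * (2 * r - 1)) : n ∉ mixedRamseySet G (starK r) := by
  intro hmem
  by_cases hn3 : n < 3
  -- With fewer than three vertices there is no room for `G`, and the identity leaves no edge free.
  · rcases hmem id with ⟨S, ⟨ψ⟩, -⟩ | ⟨S, ⟨ψ⟩, hS⟩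
    · have hinj : Function.Injective (fun a => (ψ a : Fin n)) :=
        fun a b e => ψ.injective (Subtype.ext e)
      have := Fintype.card_le_of_injective _ hinj
      rw [Fintype.card_fin] at this
      omega
    · have hadj : (starK r).Adj (Sum.inl 0) (Sum.inr ⟨0, hr⟩) := by simp
      have hS' := ψ.map_adj_iff.2 hadj
      rw [SimpleGraph.Subgraph.coe_adj] at hS'
      exact hS (edgeOf hS'.ne) hS' hS'
  choose f hf using exists_isBlockImage (n := n) (r := r) (by omega) hr
  rcases hmem f with ⟨S, ⟨ψ⟩, hS⟩ | ⟨S, ⟨ψ⟩, hS⟩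
  · refine hG ⟨SimpleGraph.Coloring.mk
      (fun a => (⟨block r (ψ a).1, ?_⟩ : Fin s)) fun {a b} hab he => ?_⟩
    · unfold block
      rw [Nat.div_lt_iff_lt_mul (by omega)]
      exact lt_of_lt_of_le (ψ a).1.2 hn
    · have hS' := ψ.map_adj_iff.2 hab
      rw [SimpleGraph.Subgraph.coe_adj] at hS'
      rw [Fin.mk.injEq] at he
      exact (hf _).moved _ _ hS'.ne rfl he (hS (edgeOf hS'.ne) hS')
  · set v : Fin n := (ψ (Sum.inl 0)).1 with hv
    set u : Fin r → Fin n := fun i => (ψ (Sum.inr i)).1 with hu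
    have huS : ∀ i, S.Adj v (u i) := by
      intro i
      have hadj : (starK r).Adj (Sum.inl 0) (Sum.inr i) := by simp
      have hS' := ψ.map_adj_iff.2 hadj
      rwa [SimpleGraph.Subgraph.coe_adj] at hS'
    have huinj : Function.Injective u := fun i j e =>
      Sum.inr_injective (ψ.injective (Subtype.ext e))
    have hne : ∀ i, v ≠ u i := fun i => (huS i).ne
    have hblock : ∀ i, block r v = block r (u i) := by
      intro i
      by_contra hcon
      refine hS (edgeOf (hne i)) (huS i) ?_
      rw [(hf _).fixed _ _ (hne i) rfl hcon]
      exact huS i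
    obtain ⟨i, j, hij, hlt⟩ := exists_opposite hr (fun i => cyclicDiff r v (u i))
      (fun i => cyclicDiff_ne_zero (hblock i) (hne i))
      (fun i j e => huinj (eq_of_block_eq_of_cyclicDiff_eq
        ((hblock i).symm.trans (hblock j)) e))
    refine hS (edgeOf (hne i)) (huS i) ?_
    rw [(hf _).opposite v (u i) (hne i) (u j) (hne j) rfl (hblock i) (hblock j).symm hlt hij]
    exact huS j

/-- One of the `t` independent vertices together with the other `k - t` forms a clique. -/
theorem not_colorable_completeMinusClique {k t : ℕ} (ht : 1 ≤ t) (hk : t + 2 ≤ k) :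
    ¬ (completeMinusClique k t).Colorable (k - t) := by
  rintro ⟨C⟩
  let g : Fin (k - t + 1) → Fin k := fun i => ⟨t - 1 + i.1, by omega⟩
  have hinj : Function.Injective (fun i => C (g i)) := by
    intro i j e
    by_contra hij
    have hij' : i.1 ≠ j.1 := fun h => hij (Fin.ext h)
    refine C.valid (v := g i) (w := g j) ⟨fun h => ?_, fun h => ?_⟩ e
    · have := congrArg Fin.val h
      simp only [g] at this
      omega
    · simp only [g] at h
      omega
  have := Fintype.card_le_of_injective _ hinj
  rw [Fintype.card_fin, Fintype.card_fin] at this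
  omega

/-- The clique uses up `t` colours, none of which can occur on `G`. -/
theorem not_colorable_graphJoin_top {V : Type*} {G : SimpleGraph V} {c : ℕ}
    (hG : ¬ G.Colorable c) (t : ℕ) :
    ¬ (graphJoin G (⊤ : SimpleGraph (Fin t))).Colorable (t + c) := by
  classical
  rintro ⟨C⟩
  apply hG
  set T : Finset (Fin (t + c)) := Finset.univ.image (fun i : Fin t => C (Sum.inr i)) with hT
  have hTcard : T.card = t := by
    rw [hT, Finset.card_image_of_injective, Finset.card_univ, Fintype.card_fin]
    intro i j e
    by_contra hij
    exact C.valid (v := Sum.inr i) (w := Sum.inr j) (by simpa [graphJoin] using hij) e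
  have hcol : G.Coloring (Tᶜ : Finset (Fin (t + c))) := SimpleGraph.Coloring.mk
    (fun a => ⟨C (Sum.inl a), by
      rw [Finset.mem_compl, hT, Finset.mem_image]
      rintro ⟨i, -, e⟩
      exact C.valid (v := Sum.inr i) (w := Sum.inl a) (by simp [graphJoin]) e⟩)
    fun {a b} hab e => by
      rw [Subtype.mk.injEq] at e
      exact C.valid (v := Sum.inl a) (w := Sum.inl b) (by simpa [graphJoin] using hab) e
  have := hcol.colorable
  rwa [Fintype.card_coe, Finset.card_compl, hTcard, Fintype.card_fin, Nat.add_sub_cancel_left]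
    at this

theorem not_colorable_two_cycleGraph {k : ℕ} (hk : 3 ≤ k) :
    ¬ (SimpleGraph.cycleGraph (2 * k - 1)).Colorable 2 := by
  intro h
  have h1 := SimpleGraph.chromaticNumber_cycleGraph_of_odd (2 * k - 1) (by omega)
    ⟨k - 1, by omega⟩
  have h2 := h.chromaticNumber_le
  rw [h1] at h2
  exact absurd h2 (by decide)

end LowerBounds

theorem mainTheorem12 :
    (∀ k t r : ℕ, 1 ≤ t → t + 2 ≤ k → 3 * (t : ℝ) / 2 - 1 ≤ (r : ℝ) →
      MixedRamseyEq (completeMinusClique k t) (starK r) ((k - t) * (2 * r - 1) + 1)) ∧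
    (∀ k t r : ℕ, 3 ≤ k → k - 1 ≤ r →
      MixedRamseyEq
        (graphJoin (SimpleGraph.cycleGraph (2 * k - 1)) (⊤ : SimpleGraph (Fin t)))
        (starK r) ((t + 2) * (2 * r - 1) + 1)) := by
  refine ⟨fun k t r ht hk hrt => ?_, fun k t r hk hkr => ?_⟩
  · have hrt' : 3 * t ≤ 2 * r + 2 := by
      have : (3 * t : ℝ) ≤ 2 * r + 2 := by linarith
      exact_mod_cast this
    refine ⟨completeMinusClique_mem_mixedRamseySet hk ht hrt', fun n hn => ?_⟩
    by_contra hcon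
    exact not_mem_mixedRamseySet (by omega) (by rw [Fintype.card_fin]; omega)
      (not_colorable_completeMinusClique ht hk) (by omega) hn
  · refine ⟨cycleGraph_join_mem_mixedRamseySet hk hkr, fun n hn => ?_⟩
    by_contra hcon
    refine not_mem_mixedRamseySet (by omega) ?_
      (not_colorable_graphJoin_top (not_colorable_two_cycleGraph hk) t) (by omega) hn
    rw [Fintype.card_sum, Fintype.card_fin]
    omega
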